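/- Notation. For $\sigma>0$ let $\mathcal B^\infty_\sigma$ be the space of entire functions $f$ of exponential type at most $\sigma$ (for every $\epsilon>0$ there is a $C$ with $|f(z)|\le C e^{(\sigma+\epsilon)|z|}$ for all $z\in\mathbb C$) that are bounded on $\mathbb R$, with norm $\|f\|_\infty=\operatorname{ess\,sup}_{t\in\mathbb R}|f(t)|$; let $\mathcal B^\infty_{\sigma,0}$ be the set of those $f\in\mathcal B^\infty_\sigma$ with $f(t)\to0$ as $t\to\pm\infty$, $t \in \mathbb R$; and let $\mathcal{PW}^1_\sigma$ be the space of functions $f(z)=\frac1{2\pi}\int_{-\sigma}^{\sigma}g(\omega)e^{i\omega z}\,d\omega$ with $g\in L^1([-\sigma,\sigma])$. A sine-type function is an entire function $\varphi$ of exponential type $\pi$ with simple zeros, whose mutual distances are bounded below by a positive constant, such that for some constants $A,B,H>0$ one has $A e^{\pi|\eta|}\le|\varphi(\xi+i\eta)|\le B e^{\pi|\eta|}$ for all $\xi\in\mathbb R$ and all real $\eta$ with $|\eta|\ge H$. Theorem. Let $\varphi$ be a sine-type function and let $\Lambda=\{\lambda_n\}_{n\in\mathbb Z}$ be its zero set,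 each zero being listed exactly once and the zeros being numbered by nondecreasing real part, or, more generally, so that for some constant $K$ one has $\operatorname{Re}\lambda_m\le\operatorname{Re}\lambda_n+K$ whenever $m\le n$. Put $$\varphi_n(z)=\frac{\varphi(z)}{\varphi'(\lambda_n)(z-\lambda_n)}\quad(\varphi_n(\lambda_n)=1),\qquad (A_Nf)(z)=\sum_{n=-N}^{N}f(\lambda_n)\,\varphi_n(z),$$ and let $0<\beta<1$. Then: (1) $\lim_{N\to\infty}\sup_{t\in\mathbb R}|f(t)-(A_Nf)(t)|=0$ for all $f\in\mathcal B^\infty_{\beta\pi,0}$. (2) There is a constant $C>0$ such that $\limsup_{N\to\infty}\sup_{t\in\mathbb R}|f(t)-(A_Nf)(t)|\le C\,\|f\|_\infty$ for all $f\in\mathcal B^\infty_{\beta\pi}$. In general the error does not tend to $0$ here: there is an $f\in\mathcal B^\infty_{\beta\pi}$ for which $\sup_{t\in\mathbb R}|f(t)-(A_Nf)(t)|$ does not converge to $0$. (3) $\lim_{N\to\infty}\sup_{t\in\mathbb R}|f(t)-(A_Nf)(t)|=0$ for all $f\in\mathcal{PW}^1_{\beta\pi}$. -/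

import Mathlib

open Filter Topology MeasureTheory
open scoped ENNReal

namespace BandlimitedSampling

/-- `f` is an entire function of exponential type at most `σ`. -/
def IsExpType (σ : ℝ) (f : ℂ → ℂ) : Prop :=
  Differentiable ℂ f ∧
    ∀ ε : ℝ, 0 < ε → ∃ C : ℝ, ∀ z : ℂ, ‖f z‖ ≤ C * Real.exp ((σ + ε) * ‖z‖)

/-- The Bernstein space `B^p_σ`: entire functions of exponential type at most `σ` whose restriction
to the real axis belongs to `L^p(ℝ)`. -/
def Bernstein (p : ℝ≥0∞) (σ : ℝ) : Set (ℂ → ℂ) :=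
  {f | IsExpType σ f ∧ MemLp (fun t : ℝ => f t) p volume}

/-- The norm of `B^∞_σ`, i.e. the `L^∞(ℝ)` norm of the restriction to the real axis. -/
noncomputable def bernsteinNorm (f : ℂ → ℂ) : ℝ≥0∞ :=
  eLpNorm (fun t : ℝ => f t) ∞ volume

/-- The space `B^∞_{σ,0}` of all `f ∈ B^∞_σ` with `f(t) → 0` as `t → ±∞` along the real axis. -/
def BernsteinZero (σ : ℝ) : Set (ℂ → ℂ) :=
  {f | f ∈ Bernstein ∞ σ ∧ Tendsto (fun t : ℝ => f t) atTop (𝓝 0) ∧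
    Tendsto (fun t : ℝ => f t) atBot (𝓝 0)}

/-- The Paley-Wiener space `PW^p_σ` (for `1 ≤ p`). -/
def PaleyWiener (p : ℝ≥0∞) (σ : ℝ) : Set (ℂ → ℂ) :=
  {f | ∃ g : ℝ → ℂ, MemLp g p (volume.restrict (Set.Icc (-σ) σ)) ∧
    ∀ z : ℂ, f z =
      1 / (2 * (Real.pi : ℂ)) * ∫ ω in (-σ)..σ, g ω * Complex.exp (Complex.I * (ω : ℂ) * z)}

/-- Sine-type functions: entire functions of exponential type `π` with simple and separated zeros
and with `A e^{π|η|} ≤ |φ(ξ + iη)| ≤ B e^{π|η|}` for `|η| ≥ H`. -/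
structure IsSineType (φ : ℂ → ℂ) : Prop where
  expType : IsExpType Real.pi φ
  simple : ∀ z : ℂ, φ z = 0 → deriv φ z ≠ 0
  separated : ∃ δ : ℝ, 0 < δ ∧ ∀ z w : ℂ, φ z = 0 → φ w = 0 → z ≠ w → δ ≤ ‖z - w‖
  growth : ∃ A B H : ℝ, 0 < A ∧ 0 < B ∧ 0 < H ∧ ∀ z : ℂ, H ≤ |z.im| →
    A * Real.exp (Real.pi * |z.im|) ≤ ‖φ z‖ ∧ ‖φ z‖ ≤ B * Real.exp (Real.pi * |z.im|)

/-- `lam` lists the zeros of `φ`, each of them once, from left to right up to a bounded error.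
The numbering by nondecreasing real parts is the case `K = 0`; for zeros in a horizontal strip,
numbering the zeros of either half-plane by their moduli is covered as well. -/
structure IsZeroEnumeration (φ : ℂ → ℂ) (lam : ℤ → ℂ) : Prop where
  injective : Function.Injective lam
  range_eq : Set.range lam = {z : ℂ | φ z = 0}
  ordered : ∃ K : ℝ, ∀ m n : ℤ, m ≤ n → (lam m).re ≤ (lam n).re + K

/-- The interpolation kernel `φ(z) / (φ'(a) (z - a))` of a zero `a` of `φ`; its removable
singularity at `a` is filled by the value `1`. -/
noncomputable def kernel (φ : ℂ → ℂ) (a z : ℂ) : ℂ :=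
  if z = a then 1 else φ z / (deriv φ a * (z - a))

/-- The sampling series `(A_N f)(z) = ∑_{n=-N}^{N} f(λ_n) φ_n(z)`. -/
noncomputable def sampSeries (φ : ℂ → ℂ) (lam : ℤ → ℂ) (N : ℕ) (f : ℂ → ℂ) (z : ℂ) : ℂ :=
  ∑ n ∈ Finset.Icc (-(N : ℤ)) (N : ℤ), f (lam n) * kernel φ (lam n) z

/-- The uniform approximation error `sup_{t ∈ ℝ} |f(t) - (A_N f)(t)|`, with values in `[0, ∞]`. -/
noncomputable def uniformError (φ : ℂ → ℂ) (lam : ℤ → ℂ) (f : ℂ → ℂ) (N : ℕ) : ℝ≥0∞ :=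
  ⨆ t : ℝ, ‖f t - sampSeries φ lam N f t‖ₑ

end BandlimitedSampling

/-! Everything rests on one contour integral. For a vertical strip `X₁ < Re z < X₂`, the residue
theorem applied to `f(z) / (φ(z) (z - t))` on a rectangle expresses the value of `f` at `t` (or 0,
if `t` is outside) minus the sampling sum over the zeros in the strip as `φ(t) / 2πi` times the
boundary integral. Since `f` grows like `e^{γ|Im z|}` with `γ < π`, while `φ` grows like `e^{π|Im
z|}`, the horizontal sides vanish in the limit. A vertical side contributes at most a constant times
`ω`, where `|f| ≤ ω e^{γ|Im z|}` there, provided it keeps a fixed distance from the zeros and from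
`t`. The lines may depend on `t`, so such a choice always exists (`IsSineType.exists_gap`), and this
makes the estimate uniform in `t`.

The partial sum `A_N` differs from a strip sum by boundedly many terms, all far out, because the
numbering is monotone up to `K`, and each term is `O(ω)`. Hence the error is eventually at most `C
ω` (`exists_error_bound`), where `ω` measures `f` far from the imaginary axis. For bounded `f` take
`ω = ‖f‖_∞`. If `f → 0` on the real line, a Phragmén–Lindelöf argument (`exists_decay`) makes `ω`
arbitrarily small. Functions in `PW^1` tend to 0 by Riemann–Lebesgue. The constant 1 is the
counterexample: each `A_N 1` tends to 0 at infinity.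

The lower bounds for `|φ|` on vertical lines and for `|φ'|` at the zeros carry the growth at height
`H` down to the real axis by a Harnack estimate. -/

namespace BandlimitedSampling

/-! ### Residue theorem on rectangles -/

/-- The integral of `F` over the boundary of the rectangle `[a, b] × [c, d]`. -/
noncomputable def rectIntegral (F : ℂ → ℂ) (a b c d : ℝ) : ℂ :=
  (∫ x : ℝ in a..b, F (x + c * Complex.I)) - (∫ x : ℝ in a..b, F (x + d * Complex.I)) +
    Complex.I * (∫ y : ℝ in c..d, F (b + y * Complex.I)) -
    Complex.I * (∫ y : ℝ in c..d, F (a + y * Complex.I))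

theorem log_I_mul {w : ℂ} (hw : 0 < w.re) :
    Complex.log (Complex.I * w) = Complex.log w + Real.pi / 2 * Complex.I := by
  have hw0 : w ≠ 0 := by rintro rfl; simp at hw
  have h := Complex.abs_arg_lt_pi_div_two_iff.2 (Or.inl hw)
  rw [abs_lt] at h
  rw [(Complex.log_mul_eq_add_log_iff Complex.I_ne_zero hw0).2, Complex.log_I, add_comm]
  rw [Complex.arg_I]
  constructor <;> linarith [Real.pi_pos]

/-- The factor `k` turns the line, seen from `p`, into the right half-plane, where the principal
logarithm is a primitive without branch problems. -/
theorem integral_inv_horizontal (k : ℂ) (hk : k ≠ 0) (p : ℂ) (a b c : ℝ)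
    (h : ∀ x : ℝ, 0 < (k * (x + c * Complex.I - p)).re) :
    ∫ x : ℝ in a..b, 1 / ((x : ℂ) + c * Complex.I - p) =
      Complex.log (k * (b + c * Complex.I - p)) - Complex.log (k * (a + c * Complex.I - p)) := by
  have hne : ∀ x : ℝ, (x : ℂ) + c * Complex.I - p ≠ 0 := fun x h0 => by
    have := h x; rw [h0] at this; simp at this
  refine intervalIntegral.integral_eq_sub_of_hasDerivAt
    (f := fun x : ℝ => Complex.log (k * (x + c * Complex.I - p))) (fun x _ => ?_) ?_
  · have h1 : HasDerivAt (fun x : ℝ => k * ((x : ℂ) + c * Complex.I - p)) (k * 1) x :=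
      (((Complex.ofRealCLM.hasDerivAt (x := x)).add_const _).sub_const _).const_mul k
    refine (h1.clog_real (Or.inl (h x))).congr_deriv ?_
    rw [mul_div_mul_left _ _ hk]
  · refine Continuous.intervalIntegrable ?_ _ _
    exact continuous_const.div (by fun_prop) hne

theorem integral_inv_vertical (k : ℂ) (hk : k ≠ 0) (p : ℂ) (a c d : ℝ)
    (h : ∀ y : ℝ, 0 < (k * (a + y * Complex.I - p)).re) :
    Complex.I * ∫ y : ℝ in c..d, 1 / ((a : ℂ) + y * Complex.I - p) =
      Complex.log (k * (a + d * Complex.I - p)) - Complex.log (k * (a + c * Complex.I - p)) := by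
  have hne : ∀ y : ℝ, (a : ℂ) + y * Complex.I - p ≠ 0 := fun x h0 => by
    have := h x; rw [h0] at this; simp at this
  rw [← intervalIntegral.integral_const_mul]
  refine intervalIntegral.integral_eq_sub_of_hasDerivAt
    (f := fun y : ℝ => Complex.log (k * (a + y * Complex.I - p))) (fun y _ => ?_) ?_
  · have h1 : HasDerivAt (fun y : ℝ => k * ((a : ℂ) + y * Complex.I - p))
        (k * (1 * Complex.I)) y :=
      ((((Complex.ofRealCLM.hasDerivAt (x := y)).mul_const _).const_add _).sub_const _).const_mul k
    refine (h1.clog_real (Or.inl (h y))).congr_deriv ?_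
    rw [mul_div_mul_left _ _ hk]
    ring
  · refine Continuous.intervalIntegrable ?_ _ _
    exact continuous_const.mul (continuous_const.div (by fun_prop) hne)

/-- Each side uses its own rotated logarithm. At every corner two neighbouring branches differ by
`iπ/2` (`log_I_mul`), and the four jumps add up to `2πi`. -/
theorem rectIntegral_inv_sub {p : ℂ} {a b c d : ℝ} (ha : a < p.re) (hb : p.re < b)
    (hc : c < p.im) (hd : p.im < d) :
    rectIntegral (fun z => 1 / (z - p)) a b c d = 2 * Real.pi * Complex.I := by
  have hI := Complex.I_ne_zero
  unfold rectIntegral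
  rw [integral_inv_horizontal Complex.I hI p a b c (fun x => by simp; linarith),
    integral_inv_horizontal (-Complex.I) (by simp) p a b d (fun x => by simp; linarith),
    integral_inv_vertical 1 one_ne_zero p b c d (fun x => by simp; linarith),
    integral_inv_vertical (-1) (by simp) p a c d (fun x => by simp; linarith)]
  have e1 := log_I_mul (w := b + c * Complex.I - p) (by simp; linarith)
  have e2 := log_I_mul (w := -Complex.I * (b + d * Complex.I - p)) (by simp; linarith)
  have e3 := log_I_mul (w := -1 * (a + d * Complex.I - p)) (by simp; linarith)
  have e4 := log_I_mul (w := Complex.I * (a + c * Complex.I - p)) (by simp; linarith)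
  rw [show Complex.I * (-Complex.I * (b + d * Complex.I - p)) = 1 * (b + d * Complex.I - p) by
    linear_combination (-(b + d * Complex.I - p)) * Complex.I_sq] at e2
  rw [show Complex.I * (-1 * (a + d * Complex.I - p)) = -Complex.I * (a + d * Complex.I - p) by
    ring] at e3
  rw [show Complex.I * (Complex.I * (a + c * Complex.I - p)) = -1 * (a + c * Complex.I - p) by
    linear_combination ((a + c * Complex.I - p)) * Complex.I_sq] at e4
  rw [e1, e2, e3, e4, one_mul]
  ring

theorem rectIntegral_congr {F G : ℂ → ℂ} {a b c d : ℝ}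
    (h : ∀ z : ℂ, (z.re = a ∨ z.re = b ∨ z.im = c ∨ z.im = d) → F z = G z) :
    rectIntegral F a b c d = rectIntegral G a b c d := by
  unfold rectIntegral
  have h1 : ∀ x : ℝ, F (x + c * Complex.I) = G (x + c * Complex.I) := fun x => h _ (by simp)
  have h2 : ∀ x : ℝ, F (x + d * Complex.I) = G (x + d * Complex.I) := fun x => h _ (by simp)
  have h3 : ∀ x : ℝ, F (b + x * Complex.I) = G (b + x * Complex.I) := fun x => h _ (by simp)
  have h4 : ∀ x : ℝ, F (a + x * Complex.I) = G (a + x * Complex.I) := fun x => h _ (by simp)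
  simp only [h1, h2, h3, h4]

theorem rectIntegral_add_mul {F G : ℂ → ℂ} {a b c d : ℝ} (r : ℂ) (hab : a ≤ b) (hcd : c ≤ d)
    (hF : ∀ z : ℂ, a ≤ z.re → z.re ≤ b → c ≤ z.im → z.im ≤ d →
      (z.re = a ∨ z.re = b ∨ z.im = c ∨ z.im = d) → ContinuousAt F z)
    (hG : ∀ z : ℂ, (z.re = a ∨ z.re = b ∨ z.im = c ∨ z.im = d) → ContinuousAt G z) :
    rectIntegral (fun z => F z + r * G z) a b c d =
      rectIntegral F a b c d + r * rectIntegral G a b c d := by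
  have hor : ∀ (K : ℂ → ℂ) (y : ℝ), (∀ x ∈ Set.Icc a b, ContinuousAt K (x + y * Complex.I)) →
      IntervalIntegrable (fun x : ℝ => K (x + y * Complex.I)) volume a b := by
    intro K y hK
    refine ContinuousOn.intervalIntegrable (fun x hx => ?_)
    rw [Set.uIcc_of_le hab] at hx
    exact (ContinuousAt.comp (f := fun x : ℝ => (x : ℂ) + y * Complex.I) (hK x hx)
      (by fun_prop)).continuousWithinAt
  have ver : ∀ (K : ℂ → ℂ) (x : ℝ), (∀ y ∈ Set.Icc c d, ContinuousAt K (x + y * Complex.I)) →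
      IntervalIntegrable (fun y : ℝ => K (x + y * Complex.I)) volume c d := by
    intro K x hK
    refine ContinuousOn.intervalIntegrable (fun y hy => ?_)
    rw [Set.uIcc_of_le hcd] at hy
    exact (ContinuousAt.comp (f := fun y : ℝ => (x : ℂ) + y * Complex.I) (hK y hy)
      (by fun_prop)).continuousWithinAt
  unfold rectIntegral
  rw [intervalIntegral.integral_add, intervalIntegral.integral_add, intervalIntegral.integral_add,
    intervalIntegral.integral_add]
  · simp only [intervalIntegral.integral_const_mul]
    ring
  all_goals first
    | exact ver F _ (fun y hy => hF _ (by simp [hab]) (by simp [hab]) (by simpa using hy.1)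
        (by simpa using hy.2) (by simp))
    | exact hor F _ (fun y hy => hF _ (by simpa using hy.1) (by simpa using hy.2) (by simp [hcd])
        (by simp [hcd]) (by simp))
    | exact (ver G _ (fun y hy => hG _ (by simp))).const_mul r
    | exact (hor G _ (fun y hy => hG _ (by simp))).const_mul r

/-- The residue theorem for a rectangle and finitely many simple poles. -/
theorem rectIntegral_eq_sum_residues {a b c d : ℝ} (hab : a ≤ b) (hcd : c ≤ d) (r : ℂ → ℂ)
    (P : Finset ℂ) :
    ∀ F : ℂ → ℂ, (∀ p ∈ P, a < p.re ∧ p.re < b ∧ c < p.im ∧ p.im < d) →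
    (∀ z : ℂ, a ≤ z.re → z.re ≤ b → c ≤ z.im → z.im ≤ d → z ∉ P → DifferentiableAt ℂ F z) →
    (∀ p ∈ P, Tendsto (fun z => (z - p) * F z) (𝓝[≠] p) (𝓝 (r p))) →
    rectIntegral F a b c d = 2 * Real.pi * Complex.I * ∑ p ∈ P, r p := by
  classical
  induction P using Finset.induction_on with
  | empty =>
    intro F _ hF _
    have := Complex.integral_boundary_rect_eq_zero_of_differentiableOn F
      (a + c * Complex.I) (b + d * Complex.I) (fun z hz => by
        simp only [Complex.mem_reProdIm, Complex.add_re, Complex.ofReal_re, Complex.mul_re,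
          Complex.I_re, Complex.ofReal_im, Complex.I_im, Complex.add_im, Complex.mul_im] at hz
        simp only [mul_zero, mul_one, sub_zero, add_zero, zero_add,
          Set.uIcc_of_le hab, Set.uIcc_of_le hcd] at hz
        exact (hF z hz.1.1 hz.1.2 hz.2.1 hz.2.2 (by simp)).differentiableWithinAt)
    simpa [rectIntegral] using this
  | insert p P hp ih =>
    intro F hP hF hr
    obtain ⟨h1, h2, h3, h4⟩ := hP p (Finset.mem_insert_self _ _)
    -- Removing the principal part at `p` leaves a removable singularity. Filling it with the limit
    -- gives a function with poles only in `P`, to which the induction hypothesis applies.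
    set G0 : ℂ → ℂ := fun z => F z - r p * (1 / (z - p)) with hG0
    set G : ℂ → ℂ := Function.update G0 p (limUnder (𝓝[≠] p) G0) with hG
    have hGne : ∀ z, z ≠ p → G z = G0 z := fun z hz => Function.update_of_ne hz _ _
    have hGev : ∀ z, z ≠ p → G =ᶠ[𝓝 z] G0 := fun z hz => by
      filter_upwards [isOpen_ne.mem_nhds hz] with w hw using hGne w hw
    have hinv : ∀ z : ℂ, z ≠ p → DifferentiableAt ℂ (fun z => 1 / (z - p)) z := fun z hz =>
      (differentiableAt_const _).div (by fun_prop) (sub_ne_zero.2 hz)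
    have hbd : ∀ z : ℂ, (z.re = a ∨ z.re = b ∨ z.im = c ∨ z.im = d) → z ≠ p := by
      rintro z hz rfl
      rcases hz with h | h | h | h <;> linarith
    set U : Set ℂ := (Set.Ioo a b ×ℂ Set.Ioo c d) \ P with hU
    have hUo : IsOpen U := (isOpen_Ioo.reProdIm isOpen_Ioo).sdiff P.finite_toSet.isClosed
    have hpU : U ∈ 𝓝 p := hUo.mem_nhds ⟨⟨⟨h1, h2⟩, ⟨h3, h4⟩⟩, by simpa using hp⟩
    have hdG : DifferentiableOn ℂ G U := by
      refine Complex.differentiableOn_update_limUnder_of_isLittleO hpU (fun z hz => ?_) ?_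
      · have hzp : z ≠ p := hz.2
        refine (((hF z hz.1.1.1.1.le hz.1.1.1.2.le hz.1.1.2.1.le hz.1.1.2.2.le ?_)).sub
          ((hinv z hzp).const_mul _)).differentiableWithinAt
        simpa [hzp] using hz.1.2
      -- Here `G0 p` is a mere default value, harmless because the factor `z - p` kills it.
      · have hlim : Tendsto (fun z => (z - p) * (G0 z - G0 p)) (𝓝[≠] p) (𝓝 0) := by
          have t1 := hr p (Finset.mem_insert_self _ _)
          have t2 : Tendsto (fun z => (z - p) * G0 p) (𝓝[≠] p) (𝓝 ((p - p) * G0 p)) :=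
            (Continuous.tendsto (by fun_prop) p).mono_left nhdsWithin_le_nhds
          have t3 := (t1.sub_const (r p)).sub t2
          simp only [sub_self, zero_mul] at t3
          refine t3.congr' ?_
          filter_upwards [self_mem_nhdsWithin] with z hz
          have : z - p ≠ 0 := sub_ne_zero.2 hz
          simp only [hG0]
          field_simp
        rw [Asymptotics.isLittleO_iff_tendsto']
        · refine hlim.congr fun z => ?_
          rw [div_inv_eq_mul, mul_comm]
        · filter_upwards [self_mem_nhdsWithin] with z hz h0
          exact absurd h0 (inv_ne_zero (sub_ne_zero.2 hz))
    have hGd : ∀ z : ℂ, a ≤ z.re → z.re ≤ b → c ≤ z.im → z.im ≤ d → z ∉ P →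
        DifferentiableAt ℂ G z := by
      intro z k1 k2 k3 k4 hzP
      by_cases hzp : z = p
      · subst hzp
        exact hdG.differentiableAt hpU
      · exact ((hF z k1 k2 k3 k4 (by simp [hzp, hzP])).sub
          ((hinv z hzp).const_mul _)).congr_of_eventuallyEq (hGev z hzp)
    have hPP : ∀ q ∈ P, q ≠ p := fun q hq h => hp (h ▸ hq)
    have ihG := ih G (fun q hq => hP q (Finset.mem_insert_of_mem hq)) hGd (fun q hq => by
      have t1 := hr q (Finset.mem_insert_of_mem hq)
      have t2 : Tendsto (fun z => (z - q) * (r p * (1 / (z - p)))) (𝓝[≠] q)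
          (𝓝 ((q - q) * (r p * (1 / (q - p))))) := by
        refine Tendsto.mono_left ?_ nhdsWithin_le_nhds
        exact ((continuousAt_id.sub continuousAt_const).mul
          (continuousAt_const.mul (hinv q (hPP q hq)).continuousAt))
      have t3 := t1.sub t2
      simp only [sub_self, zero_mul, sub_zero] at t3
      refine t3.congr' ?_
      filter_upwards [nhdsWithin_le_nhds (hGev q (hPP q hq))] with z hz
      rw [hz]
      simp only [hG0]
      ring)
    have hsplit : rectIntegral F a b c d =
        rectIntegral (fun z => G z + r p * (1 / (z - p))) a b c d :=
      rectIntegral_congr fun z hz => by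
        rw [hGne z (hbd z hz)]; simp only [hG0]; ring
    rw [hsplit, rectIntegral_add_mul (r p) hab hcd, ihG, rectIntegral_inv_sub h1 h2 h3 h4,
      Finset.sum_insert hp]
    · ring
    · intro z k1 k2 k3 k4 hz
      refine (hGd z k1 k2 k3 k4 fun hzP => ?_).continuousAt
      have := hP z (Finset.mem_insert_of_mem hzP)
      rcases hz with h | h | h | h <;> linarith
    · intro z hz
      exact (hinv z (hbd z hz)).continuousAt

/-! ### Harnack and Phragmén–Lindelöf estimates -/

/-- A Harnack type estimate: a bounded holomorphic function without zeros in a disc is bounded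
below on the concentric disc of half the radius. -/
theorem le_norm_of_forall_ne_zero {g : ℂ → ℂ} {w z : ℂ} {r m M : ℝ} (hr : 0 < r) (hm : 0 < m)
    (hg : DifferentiableOn ℂ g (Metric.ball w r)) (hne : ∀ x ∈ Metric.ball w r, g x ≠ 0)
    (hM : ∀ x ∈ Metric.ball w r, ‖g x‖ ≤ M) (hw : m ≤ ‖g w‖) (hz : ‖z - w‖ ≤ r / 2) :
    m * Real.exp (-(2 * (Real.log (M / m) + 1))) ≤ ‖g z‖ := by
  have hwm : w ∈ Metric.ball w r := Metric.mem_ball_self hr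
  have hmM : m ≤ M := hw.trans (hM w hwm)
  have hM0 : 0 < M := hm.trans_le hmM
  have hlog : 0 ≤ Real.log (M / m) := Real.log_nonneg ((one_le_div hm).2 hmM)
  have hgw : 0 < ‖g w‖ := hm.trans_le hw
  have hq : DifferentiableOn ℂ (fun x => deriv g x / g x) (Metric.ball w r) :=
    (hg.deriv Metric.isOpen_ball).div hg hne
  -- A primitive of `g'/g` vanishing at `w` is a logarithm of `g / g w`. Its real part is bounded
  -- above, so Borel–Carathéodory bounds its modulus.
  obtain ⟨F, hF0, hF⟩ := hq.isExactOn_ball.with_val_at w 0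
  have hexp : ∀ x ∈ Metric.ball w r, g x = g w * Complex.exp (F x) := by
    intro x hx
    have hd : ∀ y ∈ Metric.ball w r, HasDerivAt (fun y => g y * Complex.exp (-F y)) 0 y := by
      intro y hy
      have h1 := (hg.differentiableAt (Metric.isOpen_ball.mem_nhds hy)).hasDerivAt
      refine (h1.mul (hF y hy).neg.cexp).congr_deriv ?_
      field_simp [hne y hy]
      ring
    have hc := (convex_ball w r).is_const_of_fderivWithin_eq_zero (𝕜 := ℂ)
      (fun y hy => (hd y hy).differentiableAt.differentiableWithinAt)
      (fun y hy => by
        rw [fderivWithin_of_isOpen Metric.isOpen_ball hy]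
        ext
        simpa using (hd y hy).deriv) hx hwm
    simp only [hF0, neg_zero, Complex.exp_zero, mul_one] at hc
    rw [← hc, mul_assoc, ← Complex.exp_add]
    simp
  -- The summand 1 keeps the bound positive when `M = m`, as Borel–Carathéodory requires.
  have hre : ∀ x ∈ Metric.ball w r, (F x).re ≤ Real.log (M / m) + 1 := by
    intro x hx
    have h1 : ‖g w‖ * Real.exp (F x).re ≤ M := by
      rw [← Complex.norm_exp, ← norm_mul, ← hexp x hx]
      exact hM x hx
    have h2 : Real.exp (F x).re ≤ M / m := by
      rw [le_div_iff₀ hm, mul_comm]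
      exact (mul_le_mul_of_nonneg_right hw (Real.exp_pos _).le).trans h1
    have h3 := (Real.le_log_iff_exp_le (by positivity)).2 h2
    linarith
  have hzb : z ∈ Metric.ball w r := by
    rw [mem_ball_iff_norm]; linarith
  have hmaps : ∀ x ∈ Metric.ball (0 : ℂ) r, x + w ∈ Metric.ball w r := by
    intro x hx
    simpa [mem_ball_iff_norm] using hx
  have hBC := Complex.borelCaratheodory_zero (f := fun x => F (x + w)) (z := z - w) (R := r)
    (M := Real.log (M / m) + 1) (by linarith)
    (fun x hx => by
      exact ((hF _ (hmaps x hx)).differentiableAt.comp x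
        (by fun_prop : DifferentiableAt ℂ (fun x => x + w) x)).differentiableWithinAt)
    (fun x hx => hre _ (hmaps x hx)) hr (by rw [mem_ball_zero_iff]; linarith) (by simpa using hF0)
  simp only [sub_add_cancel] at hBC
  have hle : ‖F z‖ ≤ 2 * (Real.log (M / m) + 1) := by
    refine hBC.trans ?_
    rw [div_le_iff₀ (by linarith)]
    nlinarith
  rw [hexp z hzb, norm_mul, Complex.norm_exp]
  refine mul_le_mul hw (Real.exp_le_exp.2 ?_) (Real.exp_pos _).le hgw.le
  have := Complex.abs_re_le_norm (F z)
  linarith [(abs_le.1 this).1]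

/-- By continuity the essential bound, valid on a dense set, holds at every point. -/
theorem norm_le_bernsteinNorm {σ : ℝ} {f : ℂ → ℂ} (hf : f ∈ Bernstein ∞ σ) (t : ℝ) :
    ‖f t‖ ≤ (bernsteinNorm f).toReal := by
  have hcont : Continuous fun t : ℝ => f t := hf.1.1.continuous.comp Complex.continuous_ofReal
  have hfin : bernsteinNorm f ≠ ∞ := hf.2.2.ne
  have hae : ∀ᵐ t : ℝ, ‖f t‖ ≤ (bernsteinNorm f).toReal := by
    have := ae_le_eLpNormEssSup (f := fun t : ℝ => f t) (μ := volume)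
    filter_upwards [this] with t ht
    rw [← eLpNorm_exponent_top] at ht
    rw [← toReal_enorm]
    exact ENNReal.toReal_mono hfin ht
  have hcl : IsClosed {t : ℝ | ‖f t‖ ≤ (bernsteinNorm f).toReal} :=
    isClosed_le hcont.norm continuous_const
  have hden := Measure.dense_of_ae hae
  have := hcl.closure_eq ▸ hden t
  exact this

/-- The growth bound of an entire function of exponential type, in the form used by the
Phragmen-Lindelöf principle. -/
theorem isBigO_exp_of_le {f : ℂ → ℂ} {C B : ℝ} (h : ∀ z, ‖f z‖ ≤ C * Real.exp (B * ‖z‖))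
    (l : Filter ℂ) :
    ∃ c < (2 : ℝ), ∃ B, f =O[l] fun z => Real.exp (B * ‖z‖ ^ c) :=
  ⟨1, one_lt_two, B, Asymptotics.IsBigO.of_bound C (Eventually.of_forall fun z => by
    simpa [abs_of_pos (Real.exp_pos _)] using h z)⟩

/-- After rotation to the right half-plane and multiplication by `e^{-(σ+ε)w}`, the function decays
along the positive real axis and is bounded by `M` on the imaginary axis. Phragmén–Lindelöf gives
the bound `M`, and then `ε → 0`. -/
theorem norm_le_upper {σ M : ℝ} {f : ℂ → ℂ} (hf : IsExpType σ f) (hM : ∀ t : ℝ, ‖f t‖ ≤ M) {z : ℂ}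
    (hz : 0 ≤ z.im) : ‖f z‖ ≤ M * Real.exp (σ * z.im) := by
  obtain ⟨hd, hC⟩ := hf
  have key : ∀ ε : ℝ, 0 < ε → ‖f z‖ ≤ M * Real.exp ((σ + ε) * z.im) := by
    intro ε hε
    obtain ⟨C, hC⟩ := hC (ε / 2) (by linarith)
    have hC0 : 0 ≤ C := by simpa using (norm_nonneg _).trans (hC 0)
    set g : ℂ → ℂ := fun w => f (Complex.I * w) * Complex.exp (-(σ + ε : ℝ) * w) with hg
    have hgn : ∀ w, ‖g w‖ = ‖f (Complex.I * w)‖ * Real.exp (-(σ + ε) * w.re) := by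
      intro w
      simp only [hg, norm_mul, Complex.norm_exp]
      congr 2
      rw [← Complex.ofReal_neg, Complex.re_ofReal_mul]
    have hgb : ∀ w, ‖g w‖ ≤ C * Real.exp ((σ + ε / 2) * ‖w‖ + -(σ + ε) * w.re) := by
      intro w
      rw [hgn, Real.exp_add, ← mul_assoc]
      refine mul_le_mul_of_nonneg_right ?_ (Real.exp_pos _).le
      simpa using hC (Complex.I * w)
    have h1 := PhragmenLindelof.right_half_plane_of_tendsto_zero_on_real (f := g) (C := M)
      (z := -Complex.I * z) (Differentiable.diffContOnCl (by
        simp only [hg]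
        exact (hd.comp (by fun_prop)).mul (by fun_prop)))
      (isBigO_exp_of_le (C := C) (B := |σ + ε / 2| + |σ + ε|) (fun w => (hgb w).trans (by
        refine mul_le_mul_of_nonneg_left (Real.exp_le_exp.2 ?_) hC0
        rw [add_mul |σ + ε / 2|]
        refine add_le_add (mul_le_mul_of_nonneg_right (le_abs_self _) (norm_nonneg w)) ?_
        refine (le_abs_self _).trans ?_
        rw [abs_mul, abs_neg]
        exact mul_le_mul_of_nonneg_left (Complex.abs_re_le_norm w) (abs_nonneg _))) _)
      (by
        rw [tendsto_zero_iff_norm_tendsto_zero]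
        have hlim : Tendsto (fun x : ℝ => C * Real.exp (-(ε / 2) * x)) atTop (𝓝 (C * 0)) :=
          (Real.tendsto_exp_atBot.comp
            (tendsto_id.const_mul_atTop_of_neg (by linarith))).const_mul C
        rw [mul_zero] at hlim
        refine tendsto_of_tendsto_of_tendsto_of_le_of_le' tendsto_const_nhds hlim
          (Eventually.of_forall fun _ => norm_nonneg _) ?_
        filter_upwards [eventually_ge_atTop 0] with x hx
        refine (hgb x).trans_eq ?_
        simp only [Complex.norm_real, Real.norm_eq_abs, abs_of_nonneg hx, Complex.ofReal_re]
        ring_nf)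
      (fun x => by
        rw [hgn]
        have e : Complex.I * (x * Complex.I) = ((-x : ℝ) : ℂ) := by
          push_cast; linear_combination (x : ℂ) * Complex.I_sq
        rw [e]
        simpa using hM (-x))
      (by simpa using hz)
    rw [hgn] at h1
    have e : Complex.I * (-Complex.I * z) = z := by linear_combination (-z) * Complex.I_sq
    rw [e] at h1
    have e2 : (-Complex.I * z).re = z.im := by simp
    rw [e2, neg_mul, Real.exp_neg, ← div_eq_mul_inv, div_le_iff₀ (Real.exp_pos _)] at h1
    exact h1
  have hlim : Tendsto (fun ε : ℝ => M * Real.exp ((σ + ε) * z.im)) (𝓝[>] 0)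
      (𝓝 (M * Real.exp ((σ + 0) * z.im))) :=
    (Continuous.tendsto (by fun_prop) 0).mono_left nhdsWithin_le_nhds
  rw [add_zero] at hlim
  exact ge_of_tendsto hlim (by filter_upwards [self_mem_nhdsWithin] with ε hε using key ε hε)

theorem IsExpType.comp_neg {σ : ℝ} {f : ℂ → ℂ} (hf : IsExpType σ f) :
    IsExpType σ fun z => f (-z) :=
  ⟨hf.1.comp differentiable_neg, fun ε hε => by
    obtain ⟨C, hC⟩ := hf.2 ε hε
    exact ⟨C, fun z => by simpa using hC (-z)⟩⟩

theorem IsExpType.comp_conj {σ : ℝ} {f : ℂ → ℂ} (hf : IsExpType σ f) :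
    IsExpType σ fun z => starRingEnd ℂ (f (starRingEnd ℂ z)) :=
  ⟨fun z => by simpa [Function.comp_def] using (hf.1 (starRingEnd ℂ z)).conj_conj, fun ε hε => by
    obtain ⟨C, hC⟩ := hf.2 ε hε
    exact ⟨C, fun z => by simpa using hC (starRingEnd ℂ z)⟩⟩

/-- A function of exponential type `σ` that is bounded by `M` on the real line is bounded by
`M e^{σ|Im z|}` in the plane. -/
theorem norm_le_mul_exp_abs_im {σ M : ℝ} {f : ℂ → ℂ} (hf : IsExpType σ f)
    (hM : ∀ t : ℝ, ‖f t‖ ≤ M) (z : ℂ) : ‖f z‖ ≤ M * Real.exp (σ * |z.im|) := by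
  rcases le_total 0 z.im with h | h
  · rw [abs_of_nonneg h]
    exact norm_le_upper hf hM h
  · rw [abs_of_nonpos h]
    have := norm_le_upper hf.comp_neg (fun t => by simpa using hM (-t)) (z := -z) (by simpa using h)
    simpa using this

theorem arg_le_div {z : ℂ} (hre : 0 < z.re) (him : 0 ≤ z.im) : z.arg ≤ z.im / z.re := by
  have h1 : 0 ≤ z.arg := Complex.arg_nonneg_iff.2 him
  have h2 := Complex.abs_arg_lt_pi_div_two_iff.2 (Or.inl hre)
  rw [← Complex.tan_arg]
  exact Real.le_tan h1 (abs_lt.1 h2).2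

/-- Decay in the upper right direction of a function of exponential type that tends to zero along
the positive real axis. -/
theorem exists_decay_quadrant {σ σ' M : ℝ} (hσ : σ < σ') {f : ℂ → ℂ} (hf : IsExpType σ f)
    (hM : ∀ t : ℝ, ‖f t‖ ≤ M) (h0 : Tendsto (fun t : ℝ => f t) atTop (𝓝 0)) {ε : ℝ} (hε : 0 < ε) :
    ∃ R : ℝ, ∀ z : ℂ, R ≤ z.re → 0 ≤ z.im → ‖f z‖ ≤ ε * Real.exp (σ' * z.im) := by
  -- Enlarging `M` makes the logarithm in the exponent `a` nonnegative.
  wlog hM1 : ε / 2 ≤ M generalizing M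
  · exact this (M := ε / 2) (fun t => (hM t).trans (not_le.1 hM1).le) le_rfl
  have hM0 : 0 < M := by linarith
  obtain ⟨X, hX⟩ : ∃ X : ℝ, ∀ t : ℝ, X ≤ t → ‖f t‖ ≤ ε / 2 := by
    have := (Metric.tendsto_nhds.1 h0) (ε / 2) (by linarith)
    obtain ⟨X, hX⟩ := eventually_atTop.1 this
    exact ⟨X, fun t ht => by simpa using (hX t ht).le⟩
  -- The last factor of `g` has modulus `e^{-a arg(w+i)}`. It is at most 1 on the quadrant, and `a`
  -- makes it exactly `(ε/2)/M` on the imaginary axis, where the argument is `π/2`. So `|g| ≤ ε/2`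
  -- on both edges, hence inside.
  set a : ℝ := 2 / Real.pi * Real.log (M / (ε / 2)) with ha
  have hlog : 0 ≤ Real.log (M / (ε / 2)) := Real.log_nonneg ((one_le_div (by linarith)).2 hM1)
  have ha0 : 0 ≤ a := by have := Real.pi_pos; positivity
  obtain ⟨C, hC⟩ := hf.2 1 one_pos
  have hC0 : 0 ≤ C := by simpa using (norm_nonneg _).trans (hC 0)
  set g : ℂ → ℂ := fun w => f (w + X) * Complex.exp (Complex.I * σ * w) *
    Complex.exp (Complex.I * a * Complex.log (w + Complex.I)) with hg
  have hgn : ∀ w, ‖g w‖ = ‖f (w + X)‖ * Real.exp (-(σ * w.im)) *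
      Real.exp (-(a * (w + Complex.I).arg)) := by
    intro w
    simp only [hg, norm_mul, Complex.norm_exp]
    congr 2
    · simp
    · simp [Complex.log_im]
  have harg0 : ∀ w : ℂ, 0 ≤ w.im → 0 ≤ (w + Complex.I).arg := fun w hw =>
    Complex.arg_nonneg_iff.2 (by simp; linarith)
  have hclos : closure (Set.Ioi (0 : ℝ) ×ℂ Set.Ioi (0 : ℝ)) ⊆ {w : ℂ | 0 ≤ w.re ∧ 0 ≤ w.im} := by
    refine closure_minimal (fun w hw => ⟨le_of_lt hw.1, le_of_lt hw.2⟩) ?_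
    exact (isClosed_le continuous_const Complex.continuous_re).inter
      (isClosed_le continuous_const Complex.continuous_im)
  have hgd : ∀ w : ℂ, 0 ≤ w.re → 0 ≤ w.im → DifferentiableAt ℂ g w := by
    intro w h1 h2
    have hs : w + Complex.I ∈ Complex.slitPlane := Or.inr (by simp; linarith)
    have h3 : DifferentiableAt ℂ (fun w => Complex.log (w + Complex.I)) w :=
      (differentiableAt_id.add_const _).clog hs
    have h4 : DifferentiableAt ℂ (fun w => f (w + X)) w := (hf.1 _).comp w (by fun_prop)
    exact (h4.mul (by fun_prop)).mul ((h3.const_mul _).cexp)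
  have hgC : ∀ w : ℂ, 0 ≤ w.re → 0 ≤ w.im → ‖g w‖ ≤ ε / 2 := by
    intro w h1 h2
    refine PhragmenLindelof.quadrant_I (f := g) ?_ ?_ ?_ ?_ h1 h2
    · refine DifferentiableOn.diffContOnCl fun w hw => ?_
      exact (hgd w (hclos hw).1 (hclos hw).2).differentiableWithinAt
    · refine ⟨1, one_lt_two, |σ + 1| + |σ|, Asymptotics.IsBigO.of_bound
        (C * Real.exp (|σ + 1| * |X|)) ?_⟩
      refine eventually_inf_principal.2 (Eventually.of_forall fun w hw => ?_)
      rw [hgn, Real.norm_of_nonneg (Real.exp_pos _).le, Real.rpow_one, add_mul, Real.exp_add]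
      have e1 : ‖f (w + X)‖ ≤ C * Real.exp (|σ + 1| * |X|) * Real.exp (|σ + 1| * ‖w‖) := by
        refine (hC _).trans ?_
        rw [mul_assoc, ← Real.exp_add]
        refine mul_le_mul_of_nonneg_left (Real.exp_le_exp.2 ?_) hC0
        have : ‖w + X‖ ≤ ‖w‖ + |X| := by simpa using norm_add_le w (X : ℂ)
        calc (σ + 1) * ‖w + X‖ ≤ |σ + 1| * ‖w + X‖ :=
              mul_le_mul_of_nonneg_right (le_abs_self _) (norm_nonneg _)
          _ ≤ |σ + 1| * (‖w‖ + |X|) := mul_le_mul_of_nonneg_left this (abs_nonneg _)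
          _ = _ := by ring
      have e2 : Real.exp (-(σ * w.im)) ≤ Real.exp (|σ| * ‖w‖) := by
        refine Real.exp_le_exp.2 ((neg_le_abs _).trans ?_)
        rw [abs_mul]
        exact mul_le_mul_of_nonneg_left (Complex.abs_im_le_norm w) (abs_nonneg _)
      have e3 : Real.exp (-(a * (w + Complex.I).arg)) ≤ 1 := by
        rw [Real.exp_le_one_iff, neg_nonpos]
        exact mul_nonneg ha0 (harg0 w (le_of_lt hw.2))
      calc _ ≤ (C * Real.exp (|σ + 1| * |X|) * Real.exp (|σ + 1| * ‖w‖) *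
            Real.exp (|σ| * ‖w‖)) * 1 := by gcongr
        _ = _ := by ring
    · intro x hx
      rw [hgn]
      have e3 : Real.exp (-(a * ((x : ℂ) + Complex.I).arg)) ≤ 1 := by
        rw [Real.exp_le_one_iff, neg_nonpos]
        exact mul_nonneg ha0 (harg0 x (by simp))
      have e1 := hX (x + X) (by linarith)
      push_cast at e1
      simp only [Complex.ofReal_im, mul_zero, neg_zero, Real.exp_zero, mul_one]
      exact (mul_le_of_le_one_right (norm_nonneg _) e3).trans e1
    · intro x hx
      rw [hgn]
      have e1 := norm_le_mul_exp_abs_im hf hM (x * Complex.I + X)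
      have e2 : ((x : ℂ) * Complex.I + Complex.I).arg = Real.pi / 2 := by
        have : (x : ℂ) * Complex.I + Complex.I = ((x + 1 : ℝ) : ℂ) * Complex.I := by
          push_cast; ring
        rw [this, Complex.arg_real_mul _ (by linarith), Complex.arg_I]
      have e3 : a * (Real.pi / 2) = Real.log (M / (ε / 2)) := by
        have := Real.pi_pos
        rw [ha]; field_simp
      rw [e2, e3, ← Real.log_inv, Real.exp_log (by positivity)]
      simp only [Complex.add_im, Complex.mul_im, Complex.ofReal_re, Complex.I_im, mul_one,
        Complex.ofReal_im, Complex.I_re, mul_zero, add_zero, abs_of_nonneg hx] at e1 ⊢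
      calc ‖f (x * Complex.I + X)‖ * Real.exp (-(σ * x)) * (M / (ε / 2))⁻¹
          ≤ M * Real.exp (σ * x) * Real.exp (-(σ * x)) * (M / (ε / 2))⁻¹ := by gcongr
        _ = ε / 2 := by
          rw [mul_assoc M, ← Real.exp_add, add_neg_cancel, Real.exp_zero]
          field_simp
  -- Above height `Y` the gap `σ' - σ` alone gives the decay. Below it the argument tends to 0 as
  -- `Re z` grows.
  obtain ⟨Y, hY⟩ : ∃ Y : ℝ, ∀ y, Y ≤ y → M * Real.exp (-((σ' - σ) * y)) ≤ ε := by
    have hlim : Tendsto (fun y : ℝ => M * Real.exp (-((σ' - σ) * y))) atTop (𝓝 (M * 0)) := by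
      refine (Real.tendsto_exp_atBot.comp ?_).const_mul M
      exact tendsto_neg_atTop_atBot.comp (tendsto_id.const_mul_atTop (by linarith))
    rw [mul_zero] at hlim
    exact eventually_atTop.1 (hlim.eventually (ge_mem_nhds hε))
  have hYp : 0 ≤ |Y| + 1 := by positivity
  -- To the right of this abscissa and below height `Y`, `a arg ≤ log 2`, so the auxiliary factor
  -- costs at most 2, which turns `ε/2` into `ε`.
  refine ⟨X + (a * (|Y| + 1) / Real.log 2 + 1), fun z hz1 hz2 => ?_⟩
  have hlog2 : 0 < Real.log 2 := Real.log_pos one_lt_two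
  have hq : 0 ≤ a * (|Y| + 1) / Real.log 2 := by positivity
  rcases le_total Y z.im with h | h
  · have e1 := norm_le_upper hf hM hz2
    calc ‖f z‖ ≤ M * Real.exp (σ * z.im) := e1
      _ = M * Real.exp (-((σ' - σ) * z.im)) * Real.exp (σ' * z.im) := by
        rw [mul_assoc, ← Real.exp_add]; ring_nf
      _ ≤ ε * Real.exp (σ' * z.im) :=
        mul_le_mul_of_nonneg_right (hY _ h) (Real.exp_pos _).le
  · have e1 := hgC (z - X) (by simp; linarith) (by simpa using hz2)
    rw [hgn, sub_add_cancel] at e1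
    have e2 := arg_le_div (z := z - X + Complex.I) (by simp; linarith) (by simp; linarith)
    simp only [Complex.add_im, Complex.sub_im, Complex.ofReal_im, sub_zero, Complex.I_im,
      Complex.add_re, Complex.sub_re, Complex.ofReal_re, Complex.I_re, add_zero] at e1 e2
    have hxp : 0 < z.re - X := by linarith
    have e3 : a * (z - X + Complex.I).arg ≤ Real.log 2 := by
      calc a * (z - X + Complex.I).arg ≤ a * ((z.im + 1) / (z.re - X)) := by gcongr
        _ ≤ a * ((|Y| + 1) / (z.re - X)) := by
          gcongr
          exact h.trans (le_abs_self _)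
        _ ≤ Real.log 2 := by
          rw [← mul_div_assoc, div_le_iff₀ hxp]
          have : a * (|Y| + 1) / Real.log 2 ≤ z.re - X := by linarith
          rwa [div_le_iff₀ hlog2, mul_comm (z.re - X)] at this
    have e4 : 1 / 2 ≤ Real.exp (-(a * (z - X + Complex.I).arg)) := by
      have : Real.exp (-Real.log 2) = 1 / 2 := by
        rw [Real.exp_neg, Real.exp_log two_pos]; norm_num
      rw [← this]
      exact Real.exp_le_exp.2 (by linarith)
    have e5 : ‖f z‖ * Real.exp (-(σ * z.im)) ≤ ε := by
      have hn : 0 ≤ ‖f z‖ * Real.exp (-(σ * z.im)) := by positivity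
      nlinarith
    rw [Real.exp_neg, ← div_eq_mul_inv, div_le_iff₀ (Real.exp_pos _)] at e5
    refine e5.trans (mul_le_mul_of_nonneg_left (Real.exp_le_exp.2 ?_) hε.le)
    exact mul_le_mul_of_nonneg_right hσ.le hz2

/-- The other quadrants follow by the reflections `z ↦ conj z` and `z ↦ -z`. -/
theorem exists_decay {σ σ' M : ℝ} (hσ : σ < σ') {f : ℂ → ℂ} (hf : IsExpType σ f)
    (hM : ∀ t : ℝ, ‖f t‖ ≤ M) (h0 : Tendsto (fun t : ℝ => f t) atTop (𝓝 0))
    (h1 : Tendsto (fun t : ℝ => f t) atBot (𝓝 0)) {ε : ℝ} (hε : 0 < ε) :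
    ∃ R : ℝ, ∀ z : ℂ, R ≤ |z.re| → ‖f z‖ ≤ ε * Real.exp (σ' * |z.im|) := by
  have half : ∀ f : ℂ → ℂ, IsExpType σ f → (∀ t : ℝ, ‖f t‖ ≤ M) →
      Tendsto (fun t : ℝ => f t) atTop (𝓝 0) →
      ∃ R : ℝ, ∀ z : ℂ, R ≤ z.re → ‖f z‖ ≤ ε * Real.exp (σ' * |z.im|) := by
    intro f hf hM h0
    obtain ⟨R1, hR1⟩ := exists_decay_quadrant hσ hf hM h0 hε
    obtain ⟨R2, hR2⟩ := exists_decay_quadrant hσ hf.comp_conj (fun t => by simpa using hM t)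
      (by
        have := (Complex.continuous_conj.tendsto 0).comp h0
        simpa [Function.comp_def] using this) hε
    refine ⟨max R1 R2, fun z hz => ?_⟩
    rcases le_total 0 z.im with h | h
    · rw [abs_of_nonneg h]
      exact hR1 z ((le_max_left _ _).trans hz) h
    · rw [abs_of_nonpos h]
      have := hR2 (starRingEnd ℂ z) (by simpa using (le_max_right _ _).trans hz) (by simpa using h)
      simpa using this
  obtain ⟨R1, hR1⟩ := half f hf hM h0
  obtain ⟨R2, hR2⟩ := half _ hf.comp_neg (fun t => by simpa using hM (-t))
    (by
      have := h1.comp tendsto_neg_atTop_atBot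
      simpa [Function.comp_def] using this)
  refine ⟨max R1 R2, fun z hz => ?_⟩
  rcases le_total 0 z.re with h | h
  · rw [abs_of_nonneg h] at hz
    exact hR1 z ((le_max_left _ _).trans hz)
  · rw [abs_of_nonpos h] at hz
    have := hR2 (-z) (by simpa using (le_max_right _ _).trans hz)
    simpa using this

/-! ### Zeros and size of sine-type functions -/

variable {φ : ℂ → ℂ}

theorem IsSineType.exists_abs_im_lt (hφ : IsSineType φ) :
    ∃ H : ℝ, 0 < H ∧ ∀ z : ℂ, φ z = 0 → |z.im| < H := by
  obtain ⟨A, B, H, hA, hB, hH, h⟩ := hφ.growth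
  refine ⟨H, hH, fun z hz => lt_of_not_ge fun hzH => ?_⟩
  have := (h z hzH).1
  rw [hz, norm_zero] at this
  exact absurd this (not_le.2 (by positivity))

theorem IsSineType.exists_norm_le (hφ : IsSineType φ) :
    ∃ B : ℝ, 0 < B ∧ ∀ z : ℂ, ‖φ z‖ ≤ B * Real.exp (Real.pi * |z.im|) := by
  obtain ⟨A, B, H, hA, hB, hH, h⟩ := hφ.growth
  obtain ⟨C, hC⟩ := hφ.expType.2 1 one_pos
  have hC0 : 0 ≤ C := by simpa using (norm_nonneg _).trans (hC 0)
  have hpi := Real.pi_pos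
  have hE : 1 ≤ Real.exp (Real.pi * H) := Real.one_le_exp (by positivity)
  refine ⟨B * Real.exp (Real.pi * H), by positivity, fun z => ?_⟩
  rcases le_total H |z.im| with hz | hz
  · refine (h z hz).2.trans ?_
    gcongr
    exact le_mul_of_one_le_right hB.le hE
  · have hedge : ∀ w : ℂ, |w.im| = H → ‖φ w‖ ≤ B * Real.exp (Real.pi * H) := fun w hw =>
      hw ▸ (h w hw.ge).2
    have hs : ‖φ z‖ ≤ B * Real.exp (Real.pi * H) := by
      refine PhragmenLindelof.horizontal_strip (a := -H) (b := H)
        hφ.expType.1.diffContOnCl ?_ (fun w hw => hedge w (by rw [hw, abs_neg, abs_of_pos hH]))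
        (fun w hw => hedge w (by rw [hw, abs_of_pos hH])) (abs_le.1 hz).1 (abs_le.1 hz).2
      -- Phragmén–Lindelöf in a strip of width `2H` allows growth `exp(B e^{c|Re z|})` for any `c <
      -- π/(2H)`, far more than exponential type needs.
      set c : ℝ := Real.pi / (4 * H) with hc
      have hc0 : 0 < c := by positivity
      refine ⟨c, ?_, (Real.pi + 1) / c, Asymptotics.IsBigO.of_bound
        (C * Real.exp ((Real.pi + 1) * H)) (eventually_inf_principal.2
          (Eventually.of_forall fun w hw => ?_))⟩
      · rw [hc]
        gcongr <;> linarith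
      · rw [Real.norm_of_nonneg (Real.exp_pos _).le, mul_assoc, ← Real.exp_add]
        refine (hC w).trans (mul_le_mul_of_nonneg_left (Real.exp_le_exp.2 ?_) hC0)
        have h1 : |w.im| ≤ H := abs_le.2 ⟨hw.1.le, hw.2.le⟩
        have h2 := Complex.norm_le_abs_re_add_abs_im w
        have h3 : |w.re| ≤ Real.exp (c * |w.re|) / c := by
          rw [le_div_iff₀ hc0]
          linarith [Real.add_one_le_exp (c * |w.re|)]
        calc (Real.pi + 1) * ‖w‖ ≤ (Real.pi + 1) * (H + Real.exp (c * |w.re|) / c) := by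
              gcongr; linarith
          _ = _ := by ring
    refine hs.trans (le_mul_of_one_le_right (by positivity) ?_)
    exact Real.one_le_exp (by positivity)

/-- A ball of radius `δ/2` contains at most one zero, and the number of balls needed to cover the
relevant compact set does not depend on its translate `a`. -/
theorem IsSineType.exists_card_le (hφ : IsSineType φ) (ρ : ℝ) :
    ∃ M : ℕ, ∀ (a : ℝ) (s : Finset ℂ), (∀ z ∈ s, φ z = 0 ∧ |z.re - a| ≤ ρ) → s.card ≤ M := by
  obtain ⟨H, hH, hzero⟩ := hφ.exists_abs_im_lt
  obtain ⟨δ, hδ, hsep⟩ := hφ.separated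
  obtain ⟨t, -, htf, htc⟩ := (isCompact_closedBall (0 : ℂ) (ρ + H)).finite_cover_balls
    (half_pos hδ)
  refine ⟨htf.toFinset.card, fun a s hs => ?_⟩
  have hex : ∀ z ∈ s, ∃ y ∈ t, dist (z - a) y < δ / 2 := by
    intro z hz
    have hmem : z - a ∈ Metric.closedBall (0 : ℂ) (ρ + H) := by
      rw [mem_closedBall_zero_iff]
      refine (Complex.norm_le_abs_re_add_abs_im _).trans ?_
      have h1 := hzero z (hs z hz).1
      have h2 := (hs z hz).2
      simp only [Complex.sub_re, Complex.ofReal_re, Complex.sub_im, Complex.ofReal_im, sub_zero]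
      linarith
    simpa using htc hmem
  choose! y hyt hy using hex
  refine Finset.card_le_card_of_injOn y (fun z hz => by simpa using hyt z hz) ?_
  intro z hz w hw hzw
  by_contra hne
  have h1 := hsep z w (hs z hz).1 (hs w hw).1 hne
  have h2 := dist_triangle_right (z - a) (w - a) (y z)
  have h3 := hy z hz
  have h4 := hy w hw
  rw [← hzw] at h4
  have h5 : dist (z - (a : ℂ)) (w - a) = ‖z - w‖ := by rw [dist_eq_norm]; congr 1; ring
  linarith

/-- Every interval of length `l` contains a point whose distance to a given point and to the real
parts of all zeros is bounded below. -/
theorem IsSineType.exists_gap (hφ : IsSineType φ) {l : ℝ} (hl : 0 < l) :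
    ∃ d : ℝ, 0 < d ∧ ∀ a t : ℝ, ∃ X : ℝ, a ≤ X ∧ X ≤ a + l ∧ d ≤ |X - t| ∧
      ∀ z : ℂ, φ z = 0 → d ≤ |X - z.re| := by
  classical
  obtain ⟨M, hM⟩ := hφ.exists_card_le (l + 1)
  -- Pigeonhole: at most `M` nearby zeros and the point `t` give at most `M + 1` forbidden abscissas
  -- for `M + 2` candidates. The candidates are at least `3d` apart, so no forbidden one is within
  -- `d` of two of them. Zeros outside the window are farther than `1 ≥ d` anyway.
  set n : ℕ := M + 2 with hn
  have hn0 : (0 : ℝ) < n := by positivity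
  set d : ℝ := min (l / (3 * n)) 1 with hd
  have hd0 : 0 < d := by positivity
  have hd1 : d ≤ 1 := min_le_right _ _
  have hdl : d ≤ l / (3 * n) := min_le_left _ _
  refine ⟨d, hd0, fun a t => ?_⟩
  set Z : Set ℂ := {z | φ z = 0 ∧ |z.re - a| ≤ l + 1} with hZ
  have hZf : Z.Finite := by
    by_contra hinf
    obtain ⟨s, hs, hcard⟩ := Set.Infinite.exists_subset_card_eq hinf (M + 1)
    have := hM a s fun z hz => hs hz
    omega
  have hZc : hZf.toFinset.card ≤ M := hM a _ fun z hz => by simpa [hZ] using hz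
  set bad : Finset ℝ := insert t (hZf.toFinset.image Complex.re) with hbad
  have hbc : bad.card < (Finset.range n).card := by
    have h1 : bad.card ≤ _ + 1 := Finset.card_insert_le t (hZf.toFinset.image Complex.re)
    have h2 := Finset.card_image_le (s := hZf.toFinset) (f := Complex.re)
    rw [Finset.card_range]
    omega
  set x : ℕ → ℝ := fun j => a + j * (l / n) with hx
  have hln : 0 < l / n := by positivity
  have hdn : d * 3 ≤ l / n := by
    have : l / (3 * n) * 3 = l / n := by field_simp
    linarith
  obtain ⟨j, hj, hgood⟩ : ∃ j ∈ Finset.range n, ∀ b ∈ bad, d ≤ |x j - b| := by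
    by_contra hcon
    push Not at hcon
    choose! b hb hbd using hcon
    obtain ⟨j, hj, k, hk, hjk, hbe⟩ := Finset.exists_ne_map_eq_of_card_lt_of_maps_to hbc
      (f := b) (fun j hj => hb j hj)
    have h1 := hbd j hj
    have h2 := hbd k hk
    rw [← hbe] at h2
    have h3 : |x j - x k| < 2 * d := by
      have := abs_sub_le (x j) (b j) (x k)
      rw [abs_sub_comm (b j)] at this
      linarith
    have h4 : x j - x k = ((j : ℤ) - k : ℤ) * (l / n) := by simp only [hx]; push_cast; ring
    rw [h4, abs_mul, abs_of_pos hln, ← Int.cast_abs] at h3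
    have h5 : (1 : ℝ) ≤ (|(j : ℤ) - k| : ℤ) := by
      have : 0 < |(j : ℤ) - k| := abs_pos.2 (sub_ne_zero.2 (by exact_mod_cast hjk))
      exact_mod_cast this
    nlinarith
  have hjn : (j : ℝ) < n := by exact_mod_cast Finset.mem_range.1 hj
  have hj0 : 0 ≤ (j : ℝ) * (l / n) := by positivity
  have hjl : (j : ℝ) * (l / n) ≤ l := by
    calc (j : ℝ) * (l / n) ≤ n * (l / n) := by gcongr
      _ = l := by field_simp
  refine ⟨x j, by simp only [hx]; linarith, by simp only [hx]; linarith,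
    hgood t (Finset.mem_insert_self _ _), fun z hz => ?_⟩
  by_cases hza : |z.re - a| ≤ l + 1
  · refine hgood _ (Finset.mem_insert_of_mem (Finset.mem_image_of_mem _ ?_))
    simpa [hZ] using ⟨hz, hza⟩
  · have h1 := abs_sub_abs_le_abs_sub (z.re - a) (x j - a)
    have h2 : |x j - a| ≤ l := by
      simp only [hx, add_sub_cancel_left]
      rwa [abs_of_nonneg hj0]
    have h3 : |z.re - a - (x j - a)| = |x j - z.re| := by rw [abs_sub_comm]; congr 1; ring
    rw [h3] at h1
    linarith

/-- A sine-type function is bounded below on the vertical lines that stay away from its zeros. -/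
theorem IsSineType.exists_le_norm_vertical (hφ : IsSineType φ) {d : ℝ} (hd : 0 < d) :
    ∃ c : ℝ, 0 < c ∧ ∀ X : ℝ, (∀ z : ℂ, φ z = 0 → d ≤ |X - z.re|) →
      ∀ z : ℂ, z.re = X → c * Real.exp (Real.pi * |z.im|) ≤ ‖φ z‖ := by
  obtain ⟨A, _, H, hA, _, hH, hgrowth⟩ := hφ.growth
  obtain ⟨B, hB, hle⟩ := hφ.exists_norm_le
  have hpi := Real.pi_pos
  set M : ℝ := B * Real.exp (Real.pi * (H + d)) with hM
  -- Discs of radius `d` centred on the line are free of zeros, so Harnack carries the bound from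
  -- height `H` down in steps of `d/2`. The number of steps depends only on `H` and `d`, which makes
  -- the constant uniform in `X`.
  have chain : ∀ k : ℕ, ∃ c : ℝ, 0 < c ∧ ∀ X : ℝ, (∀ z : ℂ, φ z = 0 → d ≤ |X - z.re|) →
      ∀ y : ℝ, -H ≤ y → y ≤ H → H - k * (d / 2) ≤ y → c ≤ ‖φ (X + y * Complex.I)‖ := by
    intro k
    induction k with
    | zero =>
      refine ⟨A, hA, fun X _ y _ h2 h3 => ?_⟩
      have hy : y = H := by
        simp only [Nat.cast_zero, zero_mul, sub_zero] at h3
        exact le_antisymm h2 h3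
      have := (hgrowth (X + y * Complex.I) (by simp [hy, abs_of_pos hH])).1
      refine le_trans (le_mul_of_one_le_right hA.le (Real.one_le_exp ?_)) this
      positivity
    | succ k ih =>
      obtain ⟨c, hc, ih⟩ := ih
      refine ⟨c * Real.exp (-(2 * (Real.log (M / c) + 1))), by positivity,
        fun X hX y h1 h2 h3 => ?_⟩
      obtain ⟨y', hy1, hy2, hy3, hy4⟩ : ∃ y', -H ≤ y' ∧ y' ≤ H ∧ H - k * (d / 2) ≤ y' ∧
          |y - y'| ≤ d / 2 := by
        push_cast at h3
        rcases le_total (y + d / 2) H with h | h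
        · exact ⟨y + d / 2, by linarith, h, by linarith, by
            rw [abs_le]; constructor <;> linarith⟩
        · refine ⟨H, by linarith, le_rfl, ?_, by rw [abs_le]; constructor <;> linarith⟩
          have : 0 ≤ (k : ℝ) * (d / 2) := by positivity
          linarith
      refine le_norm_of_forall_ne_zero (w := X + y' * Complex.I) (r := d) hd hc
        hφ.expType.1.differentiableOn (fun x hx h0 => ?_) (fun x hx => ?_)
        (ih X hX y' hy1 hy2 hy3) ?_
      · have e1 := hX x h0
        have e2 := Complex.abs_re_le_norm (x - (X + y' * Complex.I))
        rw [mem_ball_iff_norm] at hx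
        simp only [Complex.sub_re, Complex.add_re, Complex.ofReal_re, Complex.mul_re,
          Complex.I_re, mul_zero, Complex.ofReal_im, Complex.I_im, mul_one, sub_self,
          add_zero] at e2
        rw [abs_sub_comm] at e1
        linarith
      · have e2 := Complex.abs_im_le_norm (x - (X + y' * Complex.I))
        rw [mem_ball_iff_norm] at hx
        simp only [Complex.sub_im, Complex.add_im, Complex.ofReal_im, Complex.mul_im,
          Complex.ofReal_re, Complex.I_im, mul_one, Complex.I_re, mul_zero, add_zero,
          zero_add] at e2
        refine (hle x).trans ?_
        rw [hM]
        gcongr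
        have e3 := abs_sub_abs_le_abs_sub x.im y'
        have e4 : |y'| ≤ H := abs_le.2 ⟨hy1, hy2⟩
        linarith
      · have : (X : ℂ) + y * Complex.I - (X + y' * Complex.I) = ((y - y' : ℝ) : ℂ) * Complex.I := by
          push_cast; ring
        rw [this, norm_mul, Complex.norm_I, mul_one, Complex.norm_real]
        exact hy4
  obtain ⟨k, hk⟩ := exists_nat_gt (2 * H / (d / 2))
  obtain ⟨c, hc, hchain⟩ := chain k
  refine ⟨min A (c * Real.exp (-(Real.pi * H))), by positivity, fun X hX z hz => ?_⟩
  rcases le_total H |z.im| with h | h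
  · refine le_trans ?_ (hgrowth z h).1
    gcongr
    exact min_le_left _ _
  · rw [div_lt_iff₀ (by positivity)] at hk
    have h1 := hchain X hX z.im (abs_le.1 h).1 (abs_le.1 h).2 (by
      linarith [(abs_le.1 h).1])
    rw [← hz, Complex.re_add_im] at h1
    calc min A (c * Real.exp (-(Real.pi * H))) * Real.exp (Real.pi * |z.im|)
        ≤ c * Real.exp (-(Real.pi * H)) * Real.exp (Real.pi * H) := by
          gcongr
          exact min_le_right _ _
      _ = c := by rw [mul_assoc, ← Real.exp_add, neg_add_cancel, Real.exp_zero, mul_one]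
      _ ≤ ‖φ z‖ := h1

/-- The difference quotient is entire, so the maximum principle reduces the bound to the circle of
radius `r`, where it is `|φ|/r`. -/
theorem IsSineType.exists_norm_dslope_le (hφ : IsSineType φ) {r : ℝ} (hr : 0 < r) :
    ∃ D : ℝ, 0 < D ∧ ∀ p : ℂ, φ p = 0 → ∀ z ∈ Metric.closedBall p r, ‖dslope φ p z‖ ≤ D := by
  obtain ⟨H, hH, hzero⟩ := hφ.exists_abs_im_lt
  obtain ⟨B, hB, hle⟩ := hφ.exists_norm_le
  have hpi := Real.pi_pos
  refine ⟨B * Real.exp (Real.pi * (H + r)) / r, by positivity, fun p hp z hz => ?_⟩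
  have hd : Differentiable ℂ (dslope φ p) := by
    have := (Complex.differentiableOn_dslope (c := p) (s := Set.univ) univ_mem).2
      hφ.expType.1.differentiableOn
    exact fun w => (this w trivial).differentiableAt univ_mem
  refine Complex.norm_le_of_forall_mem_frontier_norm_le (U := Metric.ball p r)
    Metric.isBounded_ball hd.diffContOnCl (fun w hw => ?_) (by rwa [closure_ball p hr.ne'])
  rw [frontier_ball p hr.ne', mem_sphere_iff_norm] at hw
  have hwp : w ≠ p := by rintro rfl; simp at hw; linarith
  rw [dslope_of_ne _ hwp, slope_def_module, hp, sub_zero, norm_smul, norm_inv, hw,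
    ← div_eq_inv_mul]
  gcongr
  refine (hle w).trans ?_
  gcongr
  have e1 := Complex.abs_im_le_norm (w - p)
  have e2 := abs_sub_abs_le_abs_sub w.im p.im
  rw [Complex.sub_im] at e1
  linarith [hzero p hp]

/-- The difference quotient at `p` has no zeros within `δ` of `p`, and its value at `p` is `φ'(p)`.
Harnack transfers a lower bound to `p` from a point within `δ/4` on a good vertical line. -/
theorem IsSineType.exists_le_norm_deriv (hφ : IsSineType φ) :
    ∃ c : ℝ, 0 < c ∧ ∀ p : ℂ, φ p = 0 → c ≤ ‖deriv φ p‖ := by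
  obtain ⟨δ, hδ, hsep⟩ := hφ.separated
  obtain ⟨d, hd, hgap⟩ := hφ.exists_gap (show 0 < δ / 4 by linarith)
  obtain ⟨c, hc, hlow⟩ := hφ.exists_le_norm_vertical hd
  obtain ⟨D, hD, hdsl⟩ := hφ.exists_norm_dslope_le hδ
  have hpi := Real.pi_pos
  set m : ℝ := c / (δ / 4) with hm
  refine ⟨m * Real.exp (-(2 * (Real.log (D / m) + 1))), by positivity, fun p hp => ?_⟩
  obtain ⟨X, hX1, hX2, -, hX⟩ := hgap p.re 0
  set w : ℂ := X + p.im * Complex.I with hw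
  have hwp : w - p = ((X - p.re : ℝ) : ℂ) := by
    apply Complex.ext <;> simp [hw]
  have hwn : ‖w - p‖ ≤ δ / 4 := by
    rw [hwp, Complex.norm_real, Real.norm_eq_abs, abs_of_nonneg (by linarith)]
    linarith
  have hφw : c ≤ ‖φ w‖ := by
    refine le_trans (le_mul_of_one_le_right hc.le (Real.one_le_exp ?_))
      (hlow X hX w (by simp [hw]))
    positivity
  have hne : w ≠ p := by
    intro h
    rw [h, hp, norm_zero] at hφw
    linarith
  have hball : ∀ x ∈ Metric.ball w (δ / 2), ‖x - p‖ < δ := by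
    intro x hx
    rw [mem_ball_iff_norm] at hx
    calc ‖x - p‖ = ‖(x - w) + (w - p)‖ := by congr 1; ring
      _ ≤ ‖x - w‖ + ‖w - p‖ := norm_add_le _ _
      _ < δ := by linarith
  rw [← dslope_same φ p]
  refine le_norm_of_forall_ne_zero (w := w) (r := δ / 2) (by linarith) (by positivity)
    ?_ (fun x hx => ?_) (fun x hx => ?_) ?_ ?_
  · exact ((Complex.differentiableOn_dslope (c := p) (s := Set.univ) univ_mem).2
      hφ.expType.1.differentiableOn).mono (Set.subset_univ _)
  · by_cases hxp : x = p
    · rw [hxp, dslope_same]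
      exact hφ.simple p hp
    · rw [dslope_of_ne _ hxp, slope_def_module, hp, sub_zero]
      refine smul_ne_zero (inv_ne_zero (sub_ne_zero.2 hxp)) fun h0 => ?_
      have := hsep x p h0 hp hxp
      linarith [hball x hx]
  · exact hdsl p hp x (mem_closedBall_iff_norm.2 (hball x hx).le)
  · rw [dslope_of_ne _ hne, slope_def_module, hp, sub_zero, norm_smul, norm_inv,
      ← div_eq_inv_mul, hm]
    have : 0 < ‖w - p‖ := norm_pos_iff.2 (sub_ne_zero.2 hne)
    gcongr
  · rw [norm_sub_rev]
    linarith

theorem kernel_eq_dslope (hφ : IsSineType φ) {p : ℂ} (hp : φ p = 0) (z : ℂ) :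
    kernel φ p z = dslope φ p z / deriv φ p := by
  unfold kernel
  split_ifs with h
  · rw [h, dslope_same, div_self (hφ.simple p hp)]
  · rw [dslope_of_ne _ h, slope_def_module, hp, sub_zero, smul_eq_mul]
    field_simp

theorem IsSineType.exists_norm_kernel_le (hφ : IsSineType φ) :
    ∃ D : ℝ, 0 < D ∧ ∀ p : ℂ, φ p = 0 → ∀ t : ℝ, ‖kernel φ p t‖ ≤ D := by
  obtain ⟨c, hc, hder⟩ := hφ.exists_le_norm_deriv
  obtain ⟨D, hD, hdsl⟩ := hφ.exists_norm_dslope_le one_pos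
  obtain ⟨B, hB, hle⟩ := hφ.exists_norm_le
  refine ⟨(D + B) / c, by positivity, fun p hp t => ?_⟩
  rw [kernel_eq_dslope hφ hp, norm_div]
  have h1 := hder p hp
  suffices h : ‖dslope φ p t‖ ≤ D + B by gcongr
  by_cases ht : (t : ℂ) ∈ Metric.closedBall p 1
  · linarith [hdsl p hp t ht]
  · rw [mem_closedBall_iff_norm, not_le] at ht
    have hne : (t : ℂ) ≠ p := by
      intro h
      rw [h, sub_self, norm_zero] at ht
      linarith
    rw [dslope_of_ne _ hne, slope_def_module, hp, sub_zero, norm_smul, norm_inv, ← div_eq_inv_mul]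
    have h2 := hle t
    simp only [Complex.ofReal_im, abs_zero, mul_zero, Real.exp_zero, mul_one] at h2
    refine (div_le_self (norm_nonneg _) ht.le).trans ?_
    linarith

/-! ### Contour integral estimate of the error for a strip -/

theorem integral_exp_neg_mul_abs_le {κ T : ℝ} (hκ : 0 < κ) :
    ∫ y in (-T)..T, Real.exp (-(κ * |y|)) ≤ 2 / κ := by
  have hderiv : ∀ y : ℝ,
      HasDerivAt (fun y => -(Real.exp (-(κ * y)) / κ)) (Real.exp (-(κ * y))) y := by
    intro y
    have h1 : HasDerivAt (fun y : ℝ => -(κ * y)) (-(κ * 1)) y := ((hasDerivAt_id y).const_mul κ).neg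
    refine ((h1.exp.div_const κ).neg).congr_deriv ?_
    field_simp
  have hint : ∀ T : ℝ, 0 ≤ T → ∫ y in (0 : ℝ)..T, Real.exp (-(κ * |y|)) ≤ 1 / κ := by
    intro T hT
    have e : ∫ y in (0 : ℝ)..T, Real.exp (-(κ * |y|)) = ∫ y in (0 : ℝ)..T, Real.exp (-(κ * y)) := by
      refine intervalIntegral.integral_congr fun y hy => ?_
      rw [Set.uIcc_of_le hT] at hy
      simp only [abs_of_nonneg hy.1]
    rw [e, intervalIntegral.integral_eq_sub_of_hasDerivAt (fun y _ => hderiv y)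
      (Continuous.intervalIntegrable (by fun_prop) _ _)]
    have : 0 < Real.exp (-(κ * T)) / κ := by positivity
    simp only [mul_zero, neg_zero, Real.exp_zero]
    linarith
  have hcont : Continuous fun y : ℝ => Real.exp (-(κ * |y|)) := by fun_prop
  rcases le_total 0 T with hT | hT
  · rw [← intervalIntegral.integral_add_adjacent_intervals (b := 0)
      (hcont.intervalIntegrable _ _) (hcont.intervalIntegrable _ _)]
    have e : ∫ y in (-T)..0, Real.exp (-(κ * |y|)) = ∫ y in (0 : ℝ)..T, Real.exp (-(κ * |y|)) := by
      have := intervalIntegral.integral_comp_neg (a := 0) (b := T)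
        (fun y : ℝ => Real.exp (-(κ * |y|)))
      simp only [abs_neg, neg_zero] at this
      exact this.symm
    rw [e]
    have := hint T hT
    have h2 : 2 / κ = 1 / κ + 1 / κ := by ring
    linarith
  · rw [intervalIntegral.integral_symm]
    have : 0 ≤ ∫ y in T..(-T), Real.exp (-(κ * |y|)) :=
      intervalIntegral.integral_nonneg (by linarith) fun y _ => (Real.exp_pos _).le
    have h2 : 0 < 2 / κ := by positivity
    linarith

theorem norm_rectIntegral_le (F : ℂ → ℂ) (a b c d : ℝ) :
    ‖rectIntegral F a b c d‖ ≤
      ‖∫ x : ℝ in a..b, F (x + c * Complex.I)‖ + ‖∫ x : ℝ in a..b, F (x + d * Complex.I)‖ +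
      ‖∫ y : ℝ in c..d, F (b + y * Complex.I)‖ + ‖∫ y : ℝ in c..d, F (a + y * Complex.I)‖ := by
  unfold rectIntegral
  refine (norm_sub_le _ _).trans ?_
  rw [norm_mul Complex.I, Complex.norm_I, one_mul]
  gcongr
  refine (norm_add_le _ _).trans ?_
  rw [norm_mul Complex.I, Complex.norm_I, one_mul]
  gcongr
  exact norm_sub_le _ _

/-- The residue computation behind the contour integral representation of the sampling error. -/
theorem rectIntegral_quotient (hφ : IsSineType φ) {f : ℂ → ℂ} (hf : Differentiable ℂ f)
    {X₁ X₂ T t : ℝ} (hX : X₁ ≤ X₂) (hT : 0 < T) (S : Finset ℂ)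
    (hS : ∀ z, z ∈ S ↔ φ z = 0 ∧ X₁ < z.re ∧ z.re < X₂)
    (him : ∀ z, φ z = 0 → |z.im| < T) (hre : ∀ z, φ z = 0 → z.re ≠ X₁ ∧ z.re ≠ X₂)
    (ht₁ : t ≠ X₁) (ht₂ : t ≠ X₂) (hφt : φ t ≠ 0) :
    rectIntegral (fun z => f z / (φ z * (z - t))) X₁ X₂ (-T) T =
      2 * Real.pi * Complex.I * (((if X₁ < t ∧ t < X₂ then f t else 0) -
        ∑ p ∈ S, f p * kernel φ p t) / φ t) := by
  classical
  set in_ : Prop := X₁ < t ∧ t < X₂ with hin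
  set P : Finset ℂ := S ∪ (if in_ then {(t : ℂ)} else ∅) with hP
  set r : ℂ → ℂ := fun p => if p = t then f t / φ t else f p / (deriv φ p * (p - t)) with hr
  have htS : (t : ℂ) ∉ S := fun h => hφt ((hS _).1 h).1
  have hd := hφ.expType.1
  have hmemP : ∀ p ∈ P, p ∈ S ∨ (p = t ∧ in_) := by
    intro p hp
    rw [hP, Finset.mem_union] at hp
    refine hp.imp_right fun h => ?_
    split_ifs at h with h1
    · exact ⟨by simpa using h, h1⟩
    · simp at h
  rw [rectIntegral_eq_sum_residues hX (by linarith) r P]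
  · congr 1
    have hdisj : Disjoint S (if in_ then {(t : ℂ)} else ∅) := by
      split_ifs
      · simpa using htS
      · simp
    rw [hP, Finset.sum_union hdisj, sub_div, sub_eq_neg_add]
    congr 1
    · rw [← neg_div, ← Finset.sum_neg_distrib, Finset.sum_div]
      refine Finset.sum_congr rfl fun p hp => ?_
      have hpt : p ≠ t := fun h => htS (h ▸ hp)
      have h1 : p - (t : ℂ) ≠ 0 := sub_ne_zero.2 hpt
      have h2 : (t : ℂ) - p ≠ 0 := sub_ne_zero.2 hpt.symm
      have h3 := hφ.simple p ((hS p).1 hp).1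
      simp only [hr, if_neg hpt, kernel, if_neg hpt.symm]
      field_simp
      ring
    · split_ifs
      · simp [hr]
      · simp
  · intro p hp
    rcases hmemP p hp with h | ⟨rfl, h⟩
    · have h1 := (hS p).1 h
      have h2 := abs_lt.1 (him p h1.1)
      exact ⟨h1.2.1, h1.2.2, h2.1, h2.2⟩
    · simpa [hT] using h
  · intro z h1 h2 _ _ hz
    rw [hP, Finset.mem_union, not_or] at hz
    have hφz : φ z ≠ 0 := fun h0 => hz.1 ((hS z).2 ⟨h0, lt_of_le_of_ne h1 (hre z h0).1.symm,
      lt_of_le_of_ne h2 (hre z h0).2⟩)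
    have hzt : z ≠ t := by
      rintro rfl
      have : in_ := ⟨lt_of_le_of_ne h1 ht₁.symm, lt_of_le_of_ne h2 ht₂⟩
      simp [this] at hz
    exact (hf z).div ((hd z).mul (by fun_prop)) (mul_ne_zero hφz (sub_ne_zero.2 hzt))
  · intro p hp
    rcases hmemP p hp with h | ⟨rfl, h⟩
    · have hpt : p ≠ t := fun h' => htS (h' ▸ h)
      have hp0 := ((hS p).1 h).1
      have h1 := hasDerivAt_iff_tendsto_slope.1 (hd p).hasDerivAt
      have h2 : Tendsto (fun z => f z) (𝓝[≠] p) (𝓝 (f p)) :=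
        (hf p).continuousAt.tendsto.mono_left nhdsWithin_le_nhds
      have h3 : Tendsto (fun z : ℂ => z - t) (𝓝[≠] p) (𝓝 (p - t)) :=
        (Continuous.tendsto (by fun_prop) p).mono_left nhdsWithin_le_nhds
      have h4 := h2.div (h1.mul h3) (mul_ne_zero (hφ.simple p hp0) (sub_ne_zero.2 hpt))
      simp only [hr, if_neg hpt]
      refine h4.congr' ?_
      filter_upwards [self_mem_nhdsWithin] with z hz
      have hzp : z - p ≠ 0 := sub_ne_zero.2 hz
      simp only [Pi.div_apply, slope_def_field, hp0, sub_zero]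
      field_simp
    · have h2 : Tendsto (fun z => f z / φ z) (𝓝[≠] (t : ℂ)) (𝓝 (f t / φ t)) :=
        ((hf t).continuousAt.div (hd t).continuousAt hφt).tendsto.mono_left nhdsWithin_le_nhds
      simp only [hr, if_true]
      refine h2.congr' ?_
      filter_upwards [self_mem_nhdsWithin] with z hz
      have hzp : z - t ≠ 0 := sub_ne_zero.2 hz
      field_simp

/-- The quotient of the growth rates leaves `e^{-(π-γ)|y|}`, so the bound does not depend on the
height `T`. -/
theorem norm_integral_vertical_le {f : ℂ → ℂ} {X T t d c ω γ : ℝ} (hγ : γ < Real.pi) (hd : 0 < d)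
    (hc : 0 < c) (hT : 0 < T) (hω : 0 ≤ ω) (hXt : d ≤ |X - t|)
    (hφ : ∀ z : ℂ, z.re = X → c * Real.exp (Real.pi * |z.im|) ≤ ‖φ z‖)
    (hf : ∀ z : ℂ, z.re = X → ‖f z‖ ≤ ω * Real.exp (γ * |z.im|)) :
    ‖∫ y : ℝ in (-T)..T, f (X + y * Complex.I) /
      (φ (X + y * Complex.I) * (X + y * Complex.I - t))‖ ≤
        ω / (c * d) * (2 / (Real.pi - γ)) := by
  have h1 : ‖∫ y : ℝ in (-T)..T, f (X + y * Complex.I) /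
      (φ (X + y * Complex.I) * (X + y * Complex.I - t))‖ ≤
      ∫ y : ℝ in (-T)..T, ω / (c * d) * Real.exp (-((Real.pi - γ) * |y|)) := by
    refine intervalIntegral.norm_integral_le_of_norm_le (by linarith)
      (Eventually.of_forall fun y _ => ?_) (Continuous.intervalIntegrable (by fun_prop) _ _)
    have e1 := hf (X + y * Complex.I) (by simp)
    have e2 := hφ (X + y * Complex.I) (by simp)
    have e3 : d ≤ ‖(X : ℂ) + y * Complex.I - t‖ := by
      refine hXt.trans ((le_of_eq ?_).trans (Complex.abs_re_le_norm _))
      simp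
    simp only [Complex.add_im, Complex.ofReal_im, Complex.mul_im, Complex.ofReal_re,
      Complex.I_im, mul_one, Complex.I_re, mul_zero, add_zero, zero_add] at e1 e2
    rw [norm_div, norm_mul]
    calc _ ≤ ω * Real.exp (γ * |y|) / (c * Real.exp (Real.pi * |y|) * d) := by gcongr
      _ = _ := by
        rw [show -((Real.pi - γ) * |y|) = γ * |y| - Real.pi * |y| by ring, Real.exp_sub]
        field_simp
  refine h1.trans ?_
  rw [intervalIntegral.integral_const_mul]
  exact mul_le_mul_of_nonneg_left (integral_exp_neg_mul_abs_le (by linarith)) (by positivity)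

theorem norm_integral_horizontal_le {f : ℂ → ℂ} {X₁ X₂ y t A M γ : ℝ}
    (hA : 0 < A) (hM : 0 ≤ M) (hX : X₁ ≤ X₂) (hy : 1 ≤ |y|)
    (hφ : ∀ z : ℂ, z.im = y → A * Real.exp (Real.pi * |z.im|) ≤ ‖φ z‖)
    (hf : ∀ z : ℂ, ‖f z‖ ≤ M * Real.exp (γ * |z.im|)) :
    ‖∫ x : ℝ in X₁..X₂, f (x + y * Complex.I) /
      (φ (x + y * Complex.I) * (x + y * Complex.I - t))‖ ≤
        M / A * (X₂ - X₁) * Real.exp (-((Real.pi - γ) * |y|)) := by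
  have h1 : ‖∫ x : ℝ in X₁..X₂, f (x + y * Complex.I) /
      (φ (x + y * Complex.I) * (x + y * Complex.I - t))‖ ≤
        M / A * Real.exp (-((Real.pi - γ) * |y|)) * |X₂ - X₁| := by
    refine intervalIntegral.norm_integral_le_of_norm_le_const fun x _ => ?_
    have e1 := hf (x + y * Complex.I)
    have e2 := hφ (x + y * Complex.I) (by simp)
    have e3 : 1 ≤ ‖(x : ℂ) + y * Complex.I - t‖ := by
      refine hy.trans ((le_of_eq ?_).trans (Complex.abs_im_le_norm _))
      simp
    simp only [Complex.add_im, Complex.ofReal_im, Complex.mul_im, Complex.ofReal_re,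
      Complex.I_im, mul_one, Complex.I_re, mul_zero, add_zero, zero_add] at e1 e2
    rw [norm_div, norm_mul]
    calc _ ≤ M * Real.exp (γ * |y|) / (A * Real.exp (Real.pi * |y|) * 1) := by gcongr
      _ = _ := by
        rw [show -((Real.pi - γ) * |y|) = γ * |y| - Real.pi * |y| by ring, Real.exp_sub]
        field_simp
  refine h1.trans (le_of_eq ?_)
  rw [abs_of_nonneg (sub_nonneg.2 hX)]
  ring

/-- The contour estimate of the sampling error for the zeros in a vertical strip. -/
theorem norm_sub_sum_le (hφ : IsSineType φ) {f : ℂ → ℂ} (hf : Differentiable ℂ f)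
    {X₁ X₂ t d c ω γ M B : ℝ} (hγ : γ < Real.pi) (hd : 0 < d) (hc : 0 < c) (hω : 0 ≤ ω)
    (hX : X₁ ≤ X₂) (S : Finset ℂ) (hS : ∀ z, z ∈ S ↔ φ z = 0 ∧ X₁ < z.re ∧ z.re < X₂)
    (hB : ‖φ t‖ ≤ B) (hM : ∀ z, ‖f z‖ ≤ M * Real.exp (γ * |z.im|))
    (hline : ∀ z : ℂ, z.re = X₁ ∨ z.re = X₂ → c * Real.exp (Real.pi * |z.im|) ≤ ‖φ z‖)
    (hω' : ∀ z : ℂ, z.re = X₁ ∨ z.re = X₂ → ‖f z‖ ≤ ω * Real.exp (γ * |z.im|))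
    (ht₁ : d ≤ |X₁ - t|) (ht₂ : d ≤ |X₂ - t|) :
    ‖(if X₁ < t ∧ t < X₂ then f t else 0) - ∑ p ∈ S, f p * kernel φ p t‖ ≤
      B * (2 / (c * d * (Real.pi - γ))) * ω := by
  have hpi := Real.pi_pos
  have hγ' : 0 < Real.pi - γ := by linarith
  have hB0 : 0 ≤ B := (norm_nonneg _).trans hB
  have htX₁ : t ≠ X₁ := by rintro rfl; simp at ht₁; linarith
  have htX₂ : t ≠ X₂ := by rintro rfl; simp at ht₂; linarith
  -- At a zero of `φ` interpolation is exact: the kernel of `t` is 1 there and all others vanish.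
  by_cases hφt : φ t = 0
  · have hzero : (if X₁ < t ∧ t < X₂ then f t else 0) - ∑ p ∈ S, f p * kernel φ p t = 0 := by
      have hk : ∀ p, (t : ℂ) ≠ p → f p * kernel φ p t = 0 := fun p hp => by
        simp [kernel, hp, hφt]
      split_ifs with h
      · rw [Finset.sum_eq_single_of_mem (t : ℂ) ((hS _).2 ⟨hφt, by simpa using h⟩)
          fun p _ hp => hk p hp.symm]
        simp [kernel]
      · rw [Finset.sum_eq_zero fun p hp => hk p ?_, sub_zero]
        rintro rfl
        exact h (by simpa using ((hS _).1 hp).2)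
    rw [hzero, norm_zero]
    positivity
  obtain ⟨A, _, H, hA, _, hH, hgrowth⟩ := hφ.growth
  have hM0 : 0 ≤ M := by simpa using (norm_nonneg _).trans (hM 0)
  set E := (if X₁ < t ∧ t < X₂ then f t else 0) - ∑ p ∈ S, f p * kernel φ p t with hE
  have hno : ∀ z : ℂ, z.re = X₁ ∨ z.re = X₂ → φ z ≠ 0 := by
    intro z hz h0
    have := hline z hz
    rw [h0, norm_zero] at this
    exact absurd this (not_le.2 (by positivity))
  -- `T ≥ H` puts the horizontal sides where `φ` is bounded below; `T ≥ 1` keeps them at distance 1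
  -- from `t`.
  have hbound : ∀ T : ℝ, max H 1 ≤ T → 2 * Real.pi * (‖E‖ / ‖φ t‖) ≤
      2 * (M / A * (X₂ - X₁) * Real.exp (-((Real.pi - γ) * T))) +
        2 * (ω / (c * d) * (2 / (Real.pi - γ))) := by
    intro T hT
    have hTH : H ≤ T := (le_max_left _ _).trans hT
    have hT1 : 1 ≤ T := (le_max_right _ _).trans hT
    have hT0 : 0 < T := by linarith
    have hres := rectIntegral_quotient hφ hf (t := t) hX hT0 S hS
      (fun z hz => by
        by_contra hcon
        have := (hgrowth z (hTH.trans (not_lt.1 hcon))).1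
        rw [hz, norm_zero] at this
        exact absurd this (not_le.2 (by positivity)))
      (fun z hz => ⟨fun h => hno z (Or.inl h) hz, fun h => hno z (Or.inr h) hz⟩) htX₁ htX₂ hφt
    have hnorm := congrArg norm hres
    have hle := norm_rectIntegral_le (fun z => f z / (φ z * (z - t))) X₁ X₂ (-T) T
    rw [hnorm, norm_mul, norm_div] at hle
    have e2 : ‖(2 * Real.pi * Complex.I : ℂ)‖ = 2 * Real.pi := by
      simp [abs_of_pos hpi]
    rw [e2] at hle
    have k1 := norm_integral_horizontal_le (φ := φ) (t := t) (y := T) hA hM0 hX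
      (by rwa [abs_of_pos hT0]) (fun z hz => (hgrowth z (by rwa [hz, abs_of_pos hT0])).1) hM
    have k2 := norm_integral_horizontal_le (φ := φ) (t := t) (y := -T) hA hM0 hX
      (by rwa [abs_neg, abs_of_pos hT0])
      (fun z hz => (hgrowth z (by rwa [hz, abs_neg, abs_of_pos hT0])).1) hM
    have k3 := norm_integral_vertical_le (φ := φ) hγ hd hc hT0 hω ht₁
      (fun z hz => hline z (Or.inl hz)) (fun z hz => hω' z (Or.inl hz))
    have k4 := norm_integral_vertical_le (φ := φ) hγ hd hc hT0 hω ht₂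
      (fun z hz => hline z (Or.inr hz)) (fun z hz => hω' z (Or.inr hz))
    rw [abs_of_pos hT0] at k1
    rw [abs_neg, abs_of_pos hT0] at k2
    linarith
  have hlim : Tendsto (fun T : ℝ => 2 * (M / A * (X₂ - X₁) * Real.exp (-((Real.pi - γ) * T))) +
        2 * (ω / (c * d) * (2 / (Real.pi - γ)))) atTop
        (𝓝 (2 * (M / A * (X₂ - X₁) * 0) + 2 * (ω / (c * d) * (2 / (Real.pi - γ))))) := by
    refine (Tendsto.const_mul _ (Tendsto.const_mul _ ?_)).add_const _
    exact Real.tendsto_exp_neg_atTop_nhds_zero.comp (tendsto_id.const_mul_atTop hγ')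
  have hfin := ge_of_tendsto hlim ((eventually_ge_atTop (max H 1)).mono hbound)
  rw [mul_zero, mul_zero, zero_add] at hfin
  have hφp : 0 < ‖φ t‖ := norm_pos_iff.2 hφt
  -- The factor `π > 1` on the left is simply dropped.
  have h3 : ‖E‖ / ‖φ t‖ ≤ 2 / (c * d * (Real.pi - γ)) * ω := by
    have hq : 0 ≤ ‖E‖ / ‖φ t‖ := by positivity
    have e : 2 * (ω / (c * d) * (2 / (Real.pi - γ))) = 2 * (2 / (c * d * (Real.pi - γ)) * ω) := by
      field_simp
    rw [e] at hfin
    nlinarith [Real.pi_gt_three]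
  rw [div_le_iff₀ hφp] at h3
  calc ‖E‖ ≤ 2 / (c * d * (Real.pi - γ)) * ω * ‖φ t‖ := h3
    _ ≤ 2 / (c * d * (Real.pi - γ)) * ω * B := by gcongr
    _ = _ := by ring

/-! ### From strips to the partial sums `A_N` -/

theorem IsSineType.finite_zeros (hφ : IsSineType φ) (a b : ℝ) :
    {z | φ z = 0 ∧ a < z.re ∧ z.re < b}.Finite := by
  obtain ⟨M, hM⟩ := hφ.exists_card_le (|a| + |b|)
  by_contra hinf
  obtain ⟨s, hs, hcard⟩ := Set.Infinite.exists_subset_card_eq hinf (M + 1)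
  have := hM 0 s fun z hz => ⟨(hs hz).1, by
    have h1 := (hs hz).2
    rw [sub_zero, abs_le]
    constructor
    · linarith [neg_abs_le a, abs_nonneg b]
    · linarith [le_abs_self b, abs_nonneg a]⟩
  omega

/-- Otherwise the quasi-monotone numbering would confine `N + 1` distinct zeros to a strip of fixed
width, which holds at most `M`. -/
theorem IsZeroEnumeration.eventually_le_re {lam : ℤ → ℂ} (hφ : IsSineType φ)
    (hlam : IsZeroEnumeration φ lam) (R : ℝ) :
    ∀ᶠ N : ℕ in atTop, R ≤ (lam N).re ∧ (lam (-N)).re ≤ -R := by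
  classical
  obtain ⟨K, hK⟩ := hlam.ordered
  have hK0 : 0 ≤ K := by linarith [hK 0 0 le_rfl]
  obtain ⟨M, hM⟩ := hφ.exists_card_le (|R| + |(lam 0).re| + K)
  have hz : ∀ n, φ (lam n) = 0 := fun n => by
    have : lam n ∈ {z | φ z = 0} := hlam.range_eq ▸ Set.mem_range_self n
    exact this
  filter_upwards [eventually_ge_atTop M] with N hN
  constructor
  · by_contra hcon
    have := hM (lam 0).re ((Finset.Icc (0 : ℤ) N).image lam) (by
      intro z hz'
      obtain ⟨n, hn, rfl⟩ := Finset.mem_image.1 hz'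
      rw [Finset.mem_Icc] at hn
      refine ⟨hz n, ?_⟩
      have h1 := hK 0 n hn.1
      have h2 := hK n N hn.2
      rw [abs_le]
      constructor
      · linarith [abs_nonneg R, abs_nonneg (lam 0).re]
      · linarith [le_abs_self R, neg_abs_le (lam 0).re])
    rw [Finset.card_image_of_injective _ hlam.injective, Int.card_Icc] at this
    omega
  · by_contra hcon
    have := hM (lam 0).re ((Finset.Icc (-N : ℤ) 0).image lam) (by
      intro z hz'
      obtain ⟨n, hn, rfl⟩ := Finset.mem_image.1 hz'
      rw [Finset.mem_Icc] at hn
      refine ⟨hz n, ?_⟩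
      have h1 := hK n 0 hn.2
      have h2 := hK (-N) n hn.1
      rw [abs_le]
      constructor
      · linarith [le_abs_self R, le_abs_self (lam 0).re]
      · linarith [abs_nonneg R, abs_nonneg (lam 0).re])
    rw [Finset.card_image_of_injective _ hlam.injective, Int.card_Icc] at this
    omega

theorem norm_sum_sub_sum_le {g : ℂ → ℂ} {m : ℝ} (A S : Finset ℂ)
    (h : ∀ z ∈ symmDiff A S, ‖g z‖ ≤ m) :
    ‖∑ z ∈ S, g z - ∑ z ∈ A, g z‖ ≤ (symmDiff A S).card * m := by
  rw [← Finset.sum_inter_add_sum_sdiff S A g, ← Finset.sum_inter_add_sum_sdiff A S g,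
    Finset.inter_comm, add_sub_add_left_eq_sub]
  calc ‖∑ z ∈ S \ A, g z - ∑ z ∈ A \ S, g z‖
      ≤ ∑ z ∈ S \ A, ‖g z‖ + ∑ z ∈ A \ S, ‖g z‖ :=
        (norm_sub_le _ _).trans (add_le_add (norm_sum_le _ _) (norm_sum_le _ _))
    _ = ∑ z ∈ symmDiff A S, ‖g z‖ := by
      rw [symmDiff_def, Finset.sup_eq_union, Finset.sum_union disjoint_sdiff_sdiff, add_comm]
    _ ≤ (symmDiff A S).card * m := by
      rw [← nsmul_eq_mul]
      exact Finset.sum_le_card_nsmul _ _ _ h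

/-- The uniform bound of the sampling error by the size of `f` far away from the imaginary axis. -/
theorem exists_error_bound {lam : ℤ → ℂ} (hφ : IsSineType φ) (hlam : IsZeroEnumeration φ lam)
    {γ : ℝ} (hγ0 : 0 ≤ γ) (hγ : γ < Real.pi) :
    ∃ C : ℝ, 0 < C ∧ ∀ (f : ℂ → ℂ) (M ω R : ℝ), Differentiable ℂ f →
      (∀ z, ‖f z‖ ≤ M * Real.exp (γ * |z.im|)) →
      (∀ z : ℂ, R ≤ |z.re| → ‖f z‖ ≤ ω * Real.exp (γ * |z.im|)) →
      ∀ᶠ N : ℕ in atTop, ∀ t : ℝ, ‖f t - sampSeries φ lam N f t‖ ≤ C * ω := by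
  classical
  obtain ⟨K, hK⟩ := hlam.ordered
  have hK0 : 0 ≤ K := by linarith [hK 0 0 le_rfl]
  obtain ⟨H, hH, hzero⟩ := hφ.exists_abs_im_lt
  obtain ⟨B, hB, hle⟩ := hφ.exists_norm_le
  obtain ⟨d, hd, hgap⟩ := hφ.exists_gap one_pos
  obtain ⟨c, hc, hlow⟩ := hφ.exists_le_norm_vertical hd
  obtain ⟨D, hD, hker⟩ := hφ.exists_norm_kernel_le
  obtain ⟨n, hn⟩ := hφ.exists_card_le (K + 1)
  have hγ' : 0 < Real.pi - γ := by linarith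
  -- The three summands pay for `f(t)` when `t` is outside the strip, for the contour integral, and
  -- for the at most `2n` terms in which `A_N` and the strip sum differ.
  refine ⟨1 + B * (2 / (c * d * (Real.pi - γ))) + 2 * n * (Real.exp (γ * H) * D), by positivity,
    fun f M ω R hf hM hω => ?_⟩
  have hω0 : 0 ≤ ω := by simpa using (norm_nonneg _).trans (hω (|R| : ℝ) (by simp [le_abs_self]))
  -- With this margin the two vertical lines, and all zeros within `K + 1` of the real parts of
  -- `λ_N` and `λ_{-N}`, lie where `|Re z| ≥ R`.
  filter_upwards [hlam.eventually_le_re hφ (|R| + K + 1)] with N hN t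
  obtain ⟨ha, hb⟩ := hN
  set a := (lam N).re with ha'
  set b := (lam (-N)).re with hb'
  -- The lines are chosen after `t`, with `d` fixed before it.
  obtain ⟨X₂, h2a, h2b, h2t, h2z⟩ := hgap a t
  obtain ⟨X₁, h1a, h1b, h1t, h1z⟩ := hgap (b - 1) t
  rw [sub_add_cancel] at h1b
  have hR := le_abs_self R
  have hR0 := abs_nonneg R
  have hfar : ∀ x : ℝ, |R| ≤ x ∨ x ≤ -|R| → R ≤ |x| := by
    rintro x (h | h)
    · exact hR.trans (h.trans (le_abs_self x))
    · exact hR.trans (le_trans (by linarith) (neg_le_abs x))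
  have hline : ∀ z : ℂ, z.re = X₁ ∨ z.re = X₂ → R ≤ |z.re| := by
    rintro z (h | h)
    · exact hfar _ (Or.inr (by linarith))
    · exact hfar _ (Or.inl (by linarith))
  set S : Finset ℂ := (hφ.finite_zeros X₁ X₂).toFinset with hS
  have hSm : ∀ z, z ∈ S ↔ φ z = 0 ∧ X₁ < z.re ∧ z.re < X₂ := fun z => by simp [hS]
  set A : Finset ℂ := (Finset.Icc (-(N : ℤ)) N).image lam with hA
  have hsum : sampSeries φ lam N f t = ∑ p ∈ A, f p * kernel φ p t := by
    rw [hA, Finset.sum_image fun x _ y _ h => hlam.injective h]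
    rfl
  have hz : ∀ n, φ (lam n) = 0 := fun n => by
    have : lam n ∈ {z | φ z = 0} := hlam.range_eq ▸ Set.mem_range_self n
    exact this
  have hsymm : ∀ p ∈ symmDiff A S, φ p = 0 ∧ (|p.re - a| ≤ K + 1 ∨ |p.re - b| ≤ K + 1) := by
    intro p hp
    rw [Finset.mem_symmDiff] at hp
    rcases hp with ⟨hpA, hpS⟩ | ⟨hpS, hpA⟩
    · obtain ⟨k, hk, rfl⟩ := Finset.mem_image.1 hpA
      rw [Finset.mem_Icc] at hk
      refine ⟨hz k, ?_⟩
      have h1 := hK k N hk.2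
      have h2 := hK (-N) k hk.1
      rw [hSm, not_and, not_and_or, not_lt, not_lt] at hpS
      rcases hpS (hz k) with h | h
      · right; rw [abs_le]; constructor <;> linarith
      · left; rw [abs_le]; constructor <;> linarith
    · rw [hSm] at hpS
      refine ⟨hpS.1, ?_⟩
      have : p ∈ Set.range lam := hlam.range_eq ▸ hpS.1
      obtain ⟨k, rfl⟩ := this
      have hk : k < -N ∨ (N : ℤ) < k := by
        by_contra hcon
        push Not at hcon
        exact hpA (Finset.mem_image_of_mem _ (Finset.mem_Icc.2 hcon))
      rcases hk with hk | hk
      · have h1 := hK k (-N) hk.le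
        right; rw [abs_le]; constructor <;> linarith
      · have h1 := hK N k hk.le
        left; rw [abs_le]; constructor <;> linarith
  have hcard : (symmDiff A S).card ≤ 2 * n := by
    rw [← Finset.card_filter_add_card_filter_not (fun p : ℂ => |p.re - a| ≤ K + 1)]
    have c1 := hn a ((symmDiff A S).filter fun p : ℂ => |p.re - a| ≤ K + 1) fun p hp => by
      rw [Finset.mem_filter] at hp
      exact ⟨(hsymm p hp.1).1, hp.2⟩
    have c2 := hn b ((symmDiff A S).filter fun p : ℂ => ¬ |p.re - a| ≤ K + 1) fun p hp => by
      rw [Finset.mem_filter] at hp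
      exact ⟨(hsymm p hp.1).1, (hsymm p hp.1).2.resolve_left hp.2⟩
    omega
  have hterm : ∀ p ∈ symmDiff A S, ‖f p * kernel φ p t‖ ≤ ω * Real.exp (γ * H) * D := by
    intro p hp
    obtain ⟨h0, hnear⟩ := hsymm p hp
    rw [norm_mul]
    have h1 : R ≤ |p.re| := by
      rcases hnear with h | h <;> rw [abs_le] at h
      · exact hfar _ (Or.inl (by linarith))
      · exact hfar _ (Or.inr (by linarith))
    have h2 : ‖f p‖ ≤ ω * Real.exp (γ * H) := by
      refine (hω p h1).trans ?_
      have := (hzero p h0).le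
      gcongr
    exact mul_le_mul h2 (hker p h0 t) (norm_nonneg _) (by positivity)
  have t1 : ‖f t - (if X₁ < t ∧ t < X₂ then f t else 0)‖ ≤ ω := by
    split_ifs with h
    · simpa using hω0
    · rw [sub_zero]
      have := hω t (by
        rw [not_and_or, not_lt, not_lt] at h
        rw [Complex.ofReal_re]
        rcases h with h | h
        · exact hfar _ (Or.inr (by linarith))
        · exact hfar _ (Or.inl (by linarith)))
      simpa using this
  have t2 := norm_sub_sum_le hφ hf hγ hd hc hω0 (by linarith) S hSm
    (t := t) (B := B) (by simpa using hle t) hM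
    (fun z hz => by
      rcases hz with hz | hz
      · exact hlow X₁ h1z z hz
      · exact hlow X₂ h2z z hz)
    (fun z hz => hω z (hline z hz)) h1t h2t
  have t3 := norm_sum_sub_sum_le (g := fun p => f p * kernel φ p t) A S hterm
  have t4 : ((symmDiff A S).card : ℝ) * (ω * Real.exp (γ * H) * D) ≤
      2 * n * (ω * Real.exp (γ * H) * D) := by
    gcongr
    exact_mod_cast hcard
  rw [hsum]
  calc ‖f t - ∑ p ∈ A, f p * kernel φ p t‖
      = ‖(f t - (if X₁ < t ∧ t < X₂ then f t else 0)) +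
          ((if X₁ < t ∧ t < X₂ then f t else 0) - ∑ p ∈ S, f p * kernel φ p t) +
          (∑ p ∈ S, f p * kernel φ p t - ∑ p ∈ A, f p * kernel φ p t)‖ := by
        congr 1; ring
    _ ≤ ω + B * (2 / (c * d * (Real.pi - γ))) * ω + 2 * n * (ω * Real.exp (γ * H) * D) :=
        norm_add₃_le.trans (add_le_add (add_le_add t1 t2) (t3.trans t4))
    _ = _ := by ring

/-! ### The counterexample and the limits in Bernstein spaces -/

theorem tendsto_kernel_atTop (hφ : IsSineType φ) (p : ℂ) :
    Tendsto (fun t : ℝ => kernel φ p t) atTop (𝓝 0) := by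
  obtain ⟨B, hB, hle⟩ := hφ.exists_norm_le
  have h1 : Tendsto (fun t : ℝ => B / (‖deriv φ p‖ * ‖(t : ℂ) - p‖)) atTop (𝓝 0) := by
    rcases eq_or_ne (deriv φ p) 0 with h | h
    · simp [h]
    refine tendsto_const_nhds.div_atTop ?_
    refine Tendsto.const_mul_atTop (norm_pos_iff.2 h) ?_
    refine tendsto_atTop_mono (fun t => ?_) (tendsto_atTop_add_const_right atTop (-p.re) tendsto_id)
    have := Complex.re_le_norm ((t : ℂ) - p)
    simpa [sub_eq_add_neg] using this
  refine squeeze_zero_norm' ?_ h1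
  filter_upwards [eventually_gt_atTop p.re] with t ht
  have hne : (t : ℂ) ≠ p := by
    rintro rfl
    simp at ht
  rw [kernel, if_neg hne, norm_div, norm_mul]
  gcongr
  simpa using hle t

theorem one_le_uniformError (hφ : IsSineType φ) (lam : ℤ → ℂ) (N : ℕ) :
    1 ≤ uniformError φ lam (fun _ => 1) N := by
  have h1 : Tendsto (fun t : ℝ => sampSeries φ lam N (fun _ => 1) t) atTop (𝓝 0) := by
    have := tendsto_finsetSum (Finset.Icc (-(N : ℤ)) N)
      fun n _ => (tendsto_kernel_atTop hφ (lam n)).const_mul (1 : ℂ)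
    simpa [sampSeries] using this
  have h2 : Tendsto (fun t : ℝ => ‖(1 : ℂ) - sampSeries φ lam N (fun _ => 1) t‖ₑ) atTop
      (𝓝 ‖(1 : ℂ) - 0‖ₑ) := (continuous_enorm.tendsto _).comp (h1.const_sub 1)
  rw [sub_zero, enorm_one] at h2
  exact le_of_tendsto' h2 fun t =>
    le_iSup (fun t : ℝ => ‖(1 : ℂ) - sampSeries φ lam N (fun _ => 1) t‖ₑ) t

theorem one_mem_bernstein {σ : ℝ} (hσ : 0 ≤ σ) : (fun _ => (1 : ℂ)) ∈ Bernstein ∞ σ := by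
  refine ⟨⟨differentiable_const _, fun ε hε => ⟨1, fun z => ?_⟩⟩, memLp_top_const _⟩
  rw [norm_one, one_mul]
  exact Real.one_le_exp (by positivity)

theorem uniformError_le {lam : ℤ → ℂ} {f : ℂ → ℂ} {N : ℕ} {r : ℝ}
    (h : ∀ t : ℝ, ‖f t - sampSeries φ lam N f t‖ ≤ r) :
    uniformError φ lam f N ≤ ENNReal.ofReal r :=
  iSup_le fun t => by
    rw [← ofReal_norm]
    exact ENNReal.ofReal_le_ofReal (h t)

theorem tendsto_uniformError_of_mem_bernsteinZero {lam : ℤ → ℂ} (hφ : IsSineType φ)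
    (hlam : IsZeroEnumeration φ lam) {β : ℝ} (hβ0 : 0 < β) (hβ1 : β < 1) {f : ℂ → ℂ}
    (hf : f ∈ BernsteinZero (β * Real.pi)) :
    Tendsto (uniformError φ lam f) atTop (𝓝 0) := by
  have hpi := Real.pi_pos
  -- Strictly between `βπ` and `π`: the decay lemma needs room below `γ`, the contour estimate room
  -- above it.
  set γ : ℝ := (1 + β) / 2 * Real.pi with hγ
  have h1 : β * Real.pi < γ := by rw [hγ]; gcongr; linarith
  have h2 : γ < Real.pi := by rw [hγ]; nlinarith
  obtain ⟨C, hC, hbound⟩ := exists_error_bound hφ hlam (by positivity : 0 ≤ γ) h2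
  rw [ENNReal.tendsto_nhds_zero]
  intro ε hε
  rcases eq_or_ne ε ∞ with rfl | hε'
  · simp
  have hεr : 0 < ε.toReal := ENNReal.toReal_pos hε.ne' hε'
  have hM := norm_le_bernsteinNorm hf.1
  obtain ⟨R, hR⟩ := exists_decay h1 hf.1.1 hM hf.2.1 hf.2.2 (div_pos hεr hC)
  have hM0 : 0 ≤ (bernsteinNorm f).toReal := ENNReal.toReal_nonneg
  filter_upwards [hbound f _ _ R hf.1.1.1 (fun z =>
    (norm_le_mul_exp_abs_im hf.1.1 hM z).trans (by gcongr)) hR] with N hN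
  refine (uniformError_le hN).trans ?_
  rw [mul_div_cancel₀ _ hC.ne', ENNReal.ofReal_toReal hε']

theorem exists_limsup_uniformError_le {lam : ℤ → ℂ} (hφ : IsSineType φ)
    (hlam : IsZeroEnumeration φ lam) {β : ℝ} (hβ0 : 0 < β) (hβ1 : β < 1) :
    ∃ C : ℝ, 0 < C ∧ ∀ f ∈ Bernstein ∞ (β * Real.pi),
      limsup (uniformError φ lam f) atTop ≤ ENNReal.ofReal C * bernsteinNorm f := by
  have hpi := Real.pi_pos
  obtain ⟨C, hC, hbound⟩ := exists_error_bound hφ hlam (by positivity : 0 ≤ β * Real.pi)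
    (by nlinarith)
  refine ⟨C, hC, fun f hf => ?_⟩
  have hM := norm_le_mul_exp_abs_im hf.1 (norm_le_bernsteinNorm hf)
  refine limsup_le_of_le (h := ?_)
  -- With `R = 0` the far region is the whole plane, so the norm of `f` itself serves as `ω`.
  filter_upwards [hbound f _ _ 0 hf.1.1 hM fun z _ => hM z] with N hN
  refine (uniformError_le hN).trans ?_
  rw [ENNReal.ofReal_mul hC.le, ENNReal.ofReal_toReal (show bernsteinNorm f ≠ ∞ from hf.2.2.ne)]

/-! ### Paley–Wiener functions vanish at infinity -/

theorem norm_exp_I_mul_le {σ ω : ℝ} (hω : |ω| ≤ σ) (z : ℂ) :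
    ‖Complex.exp (Complex.I * ω * z)‖ ≤ Real.exp (σ * ‖z‖) := by
  rw [Complex.norm_exp]
  refine Real.exp_le_exp.2 ((Complex.re_le_norm _).trans ?_)
  rw [norm_mul, norm_mul, Complex.norm_I, one_mul, Complex.norm_real, Real.norm_eq_abs]
  gcongr

theorem paleyWiener_one_subset {σ : ℝ} (hσ : 0 ≤ σ) : PaleyWiener 1 σ ⊆ BernsteinZero σ := by
  rintro f ⟨g, hg, hf⟩
  set μ : Measure ℝ := volume.restrict (Set.Ioc (-σ) σ) with hμ
  have hgi : Integrable g μ := by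
    rw [memLp_one_iff_integrable] at hg
    exact hg.mono_measure (Measure.restrict_mono Set.Ioc_subset_Icc_self le_rfl)
  have hae : ∀ᵐ ω ∂μ, |ω| ≤ σ := by
    filter_upwards [ae_restrict_mem measurableSet_Ioc] with ω hω
    exact abs_le.2 ⟨hω.1.le, hω.2⟩
  have hf' : ∀ z, f z = 1 / (2 * (Real.pi : ℂ)) *
      ∫ ω, g ω * Complex.exp (Complex.I * (ω : ℂ) * z) ∂μ := fun z => by
    rw [hf z, intervalIntegral.integral_of_le (by linarith)]
  have hmeas : ∀ z : ℂ, AEStronglyMeasurable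
      (fun ω : ℝ => g ω * Complex.exp (Complex.I * (ω : ℂ) * z)) μ := fun z =>
    hgi.1.mul (Continuous.aestronglyMeasurable (by fun_prop))
  have hbd : ∀ z : ℂ, ∀ᵐ ω ∂μ, ‖g ω * Complex.exp (Complex.I * (ω : ℂ) * z)‖ ≤
      ‖g ω‖ * Real.exp (σ * ‖z‖) := fun z => by
    filter_upwards [hae] with ω hω
    rw [norm_mul]
    gcongr
    exact norm_exp_I_mul_le hω z
  have hdiff : Differentiable ℂ f := by
    intro z₀
    have key := hasDerivAt_integral_of_dominated_loc_of_deriv_le (μ := μ) (𝕜 := ℂ)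
      (F := fun z ω => g ω * Complex.exp (Complex.I * (ω : ℂ) * z))
      (F' := fun z ω => g ω * (Complex.exp (Complex.I * (ω : ℂ) * z) * (Complex.I * ω)))
      (x₀ := z₀) (s := Metric.ball z₀ 1)
      (bound := fun ω => ‖g ω‖ * (Real.exp (σ * (‖z₀‖ + 1)) * σ))
      (Metric.ball_mem_nhds z₀ one_pos) (Eventually.of_forall hmeas)
      ((hgi.norm.mul_const _).mono' (hmeas z₀) (hbd z₀))
      (hgi.1.mul (Continuous.aestronglyMeasurable (by fun_prop)))
      (by
        filter_upwards [hae] with ω hω z hz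
        rw [mem_ball_iff_norm] at hz
        have hz' : ‖z‖ ≤ ‖z₀‖ + 1 := by
          linarith [norm_le_norm_add_norm_sub' z z₀]
        rw [norm_mul, norm_mul]
        refine mul_le_mul_of_nonneg_left (mul_le_mul ?_ ?_ (norm_nonneg _) (Real.exp_pos _).le)
          (norm_nonneg _)
        · exact (norm_exp_I_mul_le hω z).trans (by gcongr)
        · simpa using hω)
      (hgi.norm.mul_const _)
      (by
        refine Eventually.of_forall fun ω z _ => ?_
        have h1 : HasDerivAt (fun z : ℂ => Complex.I * (ω : ℂ) * z) (Complex.I * ω * 1) z :=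
          (hasDerivAt_id z).const_mul _
        rw [mul_one] at h1
        exact h1.cexp.const_mul _)
    have : f = fun z => 1 / (2 * (Real.pi : ℂ)) *
        ∫ ω, g ω * Complex.exp (Complex.I * (ω : ℂ) * z) ∂μ := funext hf'
    rw [this]
    exact (key.2.differentiableAt).const_mul _
  have hnorm : ∀ z, ‖f z‖ ≤ ‖1 / (2 * (Real.pi : ℂ))‖ * (∫ ω, ‖g ω‖ ∂μ) * Real.exp (σ * ‖z‖) := by
    intro z
    rw [hf', norm_mul, mul_assoc, ← integral_mul_const]
    gcongr
    exact norm_integral_le_of_norm_le (hgi.norm.mul_const _) (hbd z)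
  have hI : 0 ≤ ∫ ω, ‖g ω‖ ∂μ := integral_nonneg fun _ => norm_nonneg _
  have hreal : ∀ t : ℝ, ‖f t‖ ≤ ‖1 / (2 * (Real.pi : ℂ))‖ * (∫ ω, ‖g ω‖ ∂μ) := by
    intro t
    rw [hf', norm_mul]
    gcongr
    refine norm_integral_le_of_norm_le hgi.norm (Eventually.of_forall fun ω => ?_)
    have : Complex.I * (ω : ℂ) * t = ((ω * t : ℝ) : ℂ) * Complex.I := by push_cast; ring
    rw [norm_mul, this, Complex.norm_exp_ofReal_mul_I, mul_one]
  have hRL : Tendsto (fun t : ℝ => f t) (cocompact ℝ) (𝓝 0) := by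
    have h0 := Real.tendsto_integral_exp_smul_cocompact (Set.indicator (Set.Ioc (-σ) σ) g)
    -- The Fourier character is `e^{2πix}` and enters with a minus sign, hence the rescaling by
    -- `-1/(2π)`.
    have hscale : Tendsto (fun t : ℝ => t * (-(2 * Real.pi)⁻¹)) (cocompact ℝ) (cocompact ℝ) :=
      (Homeomorph.mulRight₀ (-(2 * Real.pi)⁻¹) (by simp [Real.pi_ne_zero])).isClosedEmbedding
        |>.tendsto_cocompact
    have h1 := (h0.comp hscale).const_mul (1 / (2 * (Real.pi : ℂ)))
    rw [mul_zero] at h1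
    refine h1.congr fun t => ?_
    rw [hf', hμ, ← integral_indicator measurableSet_Ioc]
    congr 1
    refine integral_congr_ae (Eventually.of_forall fun ω => ?_)
    simp only [Set.indicator_apply]
    split_ifs
    · rw [Circle.smul_def, smul_eq_mul, Real.fourierChar_apply, mul_comm]
      congr 2
      push_cast
      have : (Real.pi : ℂ) ≠ 0 := by exact_mod_cast Real.pi_ne_zero
      field_simp
    · simp
  refine ⟨⟨⟨hdiff, fun ε hε => ⟨‖1 / (2 * (Real.pi : ℂ))‖ * (∫ ω, ‖g ω‖ ∂μ),
    fun z => (hnorm z).trans ?_⟩⟩, ?_⟩, hRL.mono_left atTop_le_cocompact,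
    hRL.mono_left atBot_le_cocompact⟩
  · gcongr
    linarith
  · exact memLp_top_of_bound
      (hdiff.continuous.comp Complex.continuous_ofReal).aestronglyMeasurable _
      (Eventually.of_forall hreal)

end BandlimitedSampling

theorem theorem11 (φ : ℂ → ℂ) (hφ : BandlimitedSampling.IsSineType φ)
    (lam : ℤ → ℂ) (hlam : BandlimitedSampling.IsZeroEnumeration φ lam)
    (β : ℝ) (hβ0 : 0 < β) (hβ1 : β < 1) :
    (∀ f ∈ BandlimitedSampling.BernsteinZero (β * Real.pi),
      Tendsto (BandlimitedSampling.uniformError φ lam f) atTop (𝓝 0)) ∧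
    (∃ C : ℝ, 0 < C ∧ ∀ f ∈ BandlimitedSampling.Bernstein ∞ (β * Real.pi),
      limsup (BandlimitedSampling.uniformError φ lam f) atTop
        ≤ ENNReal.ofReal C * BandlimitedSampling.bernsteinNorm f) ∧
    (∃ f ∈ BandlimitedSampling.Bernstein ∞ (β * Real.pi),
      ¬ Tendsto (BandlimitedSampling.uniformError φ lam f) atTop (𝓝 0)) ∧
    (∀ f ∈ BandlimitedSampling.PaleyWiener 1 (β * Real.pi),
      Tendsto (BandlimitedSampling.uniformError φ lam f) atTop (𝓝 0)) := by
  have hσ : 0 ≤ β * Real.pi := by positivity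
  refine ⟨fun f hf => BandlimitedSampling.tendsto_uniformError_of_mem_bernsteinZero hφ hlam
      hβ0 hβ1 hf, BandlimitedSampling.exists_limsup_uniformError_le hφ hlam hβ0 hβ1,
    ⟨_, BandlimitedSampling.one_mem_bernstein hσ, fun h => ?_⟩, fun f hf =>
      BandlimitedSampling.tendsto_uniformError_of_mem_bernsteinZero hφ hlam hβ0 hβ1
        (BandlimitedSampling.paleyWiener_one_subset hσ hf)⟩
  have := ge_of_tendsto' h fun N => BandlimitedSampling.one_le_uniformError hφ lam N
  simp at this
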